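/- **Proposition.** Let $\mathsf S$ be a site and let $\lambda : A \to B$ be a morphism of abelian sheaves on $\mathsf S$ (a complex of length 2). *$(A,B)$-torsors.* For an object $U$ of $\mathsf S$, an $(A,B)$-torsor over $U$ is a pair $(L,x)$ where $L$ is an $A_{|U}$-torsor on $\mathsf S/U$ and $x : L \to B_{|U}$ is a morphism of sheaves with $x(a+l)=\lambda(a)+x(l)$. A morphism $(L,x)\to(K,y)$ is an $A$-equivariant morphism of sheaves $\psi : L\to K$ with $y\circ\psi=x$. The tensor product is $(L,x)\otimes(K,y)=(L\wedge^A K,\ x\wedge y)$, where $L\wedge^A K$ is the contracted product (the quotient sheaf of $L\times K$ by the relations $(a+l,k)\sim(l,a+k)$, with the action $a+(l,k)=(a+l,k)$) and $(x\wedge y)(l,k)=x(l)+y(k)$. The associativity constraint $\mathsf a$ is $((l,k),m)\mapsto(l,(k,m))$ and the commutativity constraint $\mathsf c$ is $(l,k)\mapsto(k,l)$. Together with the restriction functors these form the Picard stack $\mathscr C=\mathrm{Tors}(A,B)$. *Saavedra units.* A Saavedra unit over $U$ is an $(A,B)$-torsor $(L,x)$ over $U$ with a morphism of $(A,B)$-torsors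 $\varphi:(L,x)\otimes(L,x)\to(L,x)$. A morphism $((L,x),\varphi)\to((K,y),\sigma)$ is a morphism of $(A,B)$-torsors $\psi:(L,x)\to(K,y)$ with $\psi\circ\varphi=\sigma\circ(\psi\wedge\psi)$. Saavedra units are restricted along $f:V\to U$ by restricting $(L,x)$ and $\varphi$, using the canonical identification $f^*L\wedge^A f^*L\cong f^*(L\wedge^A L)$. Let $\mathscr I(\mathscr C)$ be the fibered category over $\mathsf S$ whose fibre over $U$ is the category of Saavedra units over $U$. Put $$((L,x),\varphi)\otimes((K,y),\sigma)=((L\wedge^A K,\ x\wedge y),\ \varphi\wedge\sigma),$$ where $\varphi\wedge\sigma$ is the composite $$(LK)(LK)\to((LK)L)K\to(L(KL))K\to(L(LK))K\to((LL)K)K\to(LL)(KK)\xrightarrow{\varphi\,\sigma}LK$$ of constraints $\mathsf a^{\pm1}$, the constraint $\mathsf c:KL\to LK$, and $\varphi$ tensored with $\sigma$ (so that $((l,k),(l',k'))\mapsto(\varphi(l,l'),\sigma(k,k'))$). *Claim.* With this tensor product, $\mathscr I(\mathscr C)$ is a (strictly commutative) Picard stack on $\mathsf S$. That is: $\mathscr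 I(\mathscr C)$ is a stack; each of its fibres is a nonempty groupoid in which tensoring with any object is an equivalence, with natural associativity and commutativity constraints satisfying the pentagon and hexagon axioms, such that the commutativity constraint is symmetric and is the identity on $E\otimes E$ for every $E$; and the restriction functors are additive, i.e. equipped with natural isomorphisms $f^*E\otimes f^*F\cong f^*(E\otimes F)$ compatible with the constraints and with the identifications $\mathrm{id}^*\cong\mathrm{id}$ and $(f\circ g)^*\cong g^*f^*$. Moreover, on underlying $(A,B)$-torsors, the associativity and commutativity constraints of $\mathscr I(\mathscr C)$ are $\mathsf a$ and $\mathsf c$, and the isomorphisms $f^*E\otimes f^*F\cong f^*(E\otimes F)$ are the canonical ones, $(l,k)\mapsto(l,k)$. -/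

import Mathlib

open CategoryTheory Opposite

universe w v u v' u'

namespace SaavedraUnits

/-! ### Gluing in a sheaf of sets -/

section Gluing

variable {D : Type u'} [Category.{v'} D] {K : GrothendieckTopology D} {R : Dᵒᵖ ⥤ Type w}

theorem eq_of_locally_eq (hR : Presheaf.IsSheaf K R) {X : D} (r r' : R.obj (op X))
    (h : ∃ S ∈ K X, ∀ ⦃Y : D⦄ (g : Y ⟶ X), S g → R.map g.op r = R.map g.op r') : r = r' := by
  obtain ⟨S, hS, h⟩ := h
  exact (hR.isSheafFor S hS).isSeparatedFor.ext (fun Y g hg => h g hg)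

theorem exists_of_locally_existsUnique (hR : Presheaf.IsSheaf K R) {X : D}
    (good : ∀ {Y : D}, (Y ⟶ X) → R.obj (op Y) → Prop)
    (hres : ∀ {Y Z : D} (g : Y ⟶ X) (h : Z ⟶ Y) (r : R.obj (op Y)),
      good g r → good (h ≫ g) (R.map h.op r))
    (huniq : ∀ {Y : D} (g : Y ⟶ X) (r r' : R.obj (op Y)), good g r → good g r' → r = r')
    (S : Sieve X) (hS : S ∈ K X) (hex : ∀ ⦃Y : D⦄ (g : Y ⟶ X), S g → ∃ r, good g r) :
    ∃ r : R.obj (op X), ∀ ⦃Y : D⦄ (g : Y ⟶ X), S g → good g (R.map g.op r) := by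
  choose r hr using hex
  have hc : Presieve.FamilyOfElements.Compatible (P := R) (R := S.arrows)
      (fun Y g hg => r g hg) := by
    intro Y₁ Y₂ Z h₁ h₂ g₁ g₂ hg₁ hg₂ e
    refine huniq (h₁ ≫ g₁) _ _ (hres _ _ _ (hr g₁ hg₁)) ?_
    rw [e]
    exact hres _ _ _ (hr g₂ hg₂)
  obtain ⟨t, ht, -⟩ := hR.isSheafFor S hS _ hc
  refine ⟨t, fun Y g hg => ?_⟩
  rw [ht g hg]
  exact hr g hg

end Gluing

/-! ### Torsors under an abelian sheaf -/

section Torsors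

variable {C : Type u} [Category.{v} C] {J : GrothendieckTopology C}
variable {A B : Sheaf J AddCommGrpCat.{max u v}}

/-- Restriction of sections of an abelian sheaf. -/
abbrev resAb (A : Sheaf J AddCommGrpCat.{max u v}) {X Y : C} (f : Y ⟶ X) :
    A.obj.obj (op X) →+ A.obj.obj (op Y) := (A.obj.map f.op).hom

theorem resAb_id {X : C} (a : A.obj.obj (op X)) : resAb A (𝟙 X) a = a :=
  congrArg (fun f => f.hom a) (A.obj.map_id (op X))

theorem resAb_comp {X Y Z : C} (g : Y ⟶ X) (h : Z ⟶ Y) (a : A.obj.obj (op X)) :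
    resAb A (h ≫ g) a = resAb A h (resAb A g a) :=
  congrArg (fun f => f.hom a) (A.obj.map_comp g.op h.op)

theorem isSheaf_forget (A : Sheaf J AddCommGrpCat.{max u v}) (U : C) :
    Presheaf.IsSheaf (J.over U) ((Over.forget U).op ⋙ A.obj ⋙ forget AddCommGrpCat.{max u v}) :=
  Functor.op_comp_isSheaf (Over.forget U) (J.over U) J
    ⟨A.obj ⋙ forget AddCommGrpCat.{max u v}, Presheaf.isSheaf_comp_of_isSheaf J _ _ A.property⟩

theorem ab_ext {U : C} {X : Over U} (a a' : A.obj.obj (op X.left))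
    (h : ∃ S ∈ J.over U X, ∀ ⦃Y : Over U⦄ (g : Y ⟶ X), S g →
      resAb A g.left a = resAb A g.left a') : a = a' :=
  eq_of_locally_eq (isSheaf_forget A U) (X := X) a a' h

theorem ab_exists {U : C} {X : Over U}
    (good : ∀ {Y : Over U}, (Y ⟶ X) → A.obj.obj (op Y.left) → Prop)
    (hres : ∀ {Y Z : Over U} (g : Y ⟶ X) (h : Z ⟶ Y) (a : A.obj.obj (op Y.left)),
      good g a → good (h ≫ g) (resAb A h.left a))
    (huniq : ∀ {Y : Over U} (g : Y ⟶ X) (a a' : A.obj.obj (op Y.left)),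
      good g a → good g a' → a = a')
    (S : Sieve X) (hS : S ∈ J.over U X)
    (hex : ∀ ⦃Y : Over U⦄ (g : Y ⟶ X), S g → ∃ a, good g a) :
    ∃ a : A.obj.obj (op X.left), ∀ ⦃Y : Over U⦄ (g : Y ⟶ X), S g → good g (resAb A g.left a) :=
  exists_of_locally_existsUnique (isSheaf_forget A U) (X := X) good hres huniq S hS hex

/-- The map on sections over `X` of a morphism of abelian sheaves. -/
abbrev onSections (lam : A ⟶ B) (X : C) : A.obj.obj (op X) →+ B.obj.obj (op X) :=
  (lam.hom.app (op X)).hom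

/-- An `A`-torsor over `U`: a sheaf of sets on the site `C/U` with an action of (the restriction
to `C/U` of) `A` which is simply transitive on sections, and which has sections locally. -/
structure ATorsor (A : Sheaf J AddCommGrpCat.{max u v}) (U : C) where
  sheaf : Sheaf (J.over U) (Type (max u v))
  action (X : Over U) : AddAction (A.obj.obj (op X.left)) (sheaf.obj.obj (op X))
  map_vadd {X Y : Over U} (g : Y ⟶ X) (a : A.obj.obj (op X.left)) (l : sheaf.obj.obj (op X)) :
    sheaf.obj.map g.op (a +ᵥ l) = resAb A g.left a +ᵥ (sheaf.obj.map g.op l : sheaf.obj.obj (op Y))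
  existsUnique_vadd (X : Over U) (l l' : sheaf.obj.obj (op X)) :
    ∃! a : A.obj.obj (op X.left), a +ᵥ l = l'
  locally_nonempty (X : Over U) :
    ∃ S ∈ J.over U X, ∀ ⦃Y : Over U⦄ (g : Y ⟶ X), S g → Nonempty (sheaf.obj.obj (op Y))

namespace ATorsor

variable {U : C} (L K : ATorsor A U)

/-- Sections of the torsor `L` over an object of `C/U`. -/
def Sec (X : Over U) : Type (max u v) := L.sheaf.obj.obj (op X)

instance (X : Over U) : AddAction (A.obj.obj (op X.left)) (L.Sec X) := L.action X

/-- Restriction of sections of a torsor. -/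
def res {X Y : Over U} (g : Y ⟶ X) (l : L.Sec X) : L.Sec Y := L.sheaf.obj.map g.op l

theorem res_id {X : Over U} (l : L.Sec X) : L.res (𝟙 X) l = l :=
  congrArg (fun f => f l) (L.sheaf.obj.map_id (op X))

theorem res_comp {X Y Z : Over U} (g : Y ⟶ X) (h : Z ⟶ Y) (l : L.Sec X) :
    L.res (h ≫ g) l = L.res h (L.res g l) :=
  congrArg (fun f => f l) (L.sheaf.obj.map_comp g.op h.op)

theorem res_vadd {X Y : Over U} (g : Y ⟶ X) (a : A.obj.obj (op X.left)) (l : L.Sec X) :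
    L.res g (a +ᵥ l) = resAb A g.left a +ᵥ L.res g l := L.map_vadd g a l

theorem exists_vadd {X : Over U} (l l' : L.Sec X) : ∃ a : A.obj.obj (op X.left), l' = a +ᵥ l := by
  obtain ⟨a, ha, -⟩ := L.existsUnique_vadd X l l'
  exact ⟨a, ha.symm⟩

theorem vadd_inj {X : Over U} {a a' : A.obj.obj (op X.left)} {l : L.Sec X}
    (h : a +ᵥ l = a' +ᵥ l) : a = a' :=
  (L.existsUnique_vadd X l (a' +ᵥ l)).unique h rfl

theorem sec_ext {X : Over U} (l l' : L.Sec X)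
    (h : ∃ S ∈ J.over U X, ∀ ⦃Y : Over U⦄ (g : Y ⟶ X), S g → L.res g l = L.res g l') : l = l' :=
  eq_of_locally_eq L.sheaf.property l l' h

/-- `(l, k)` and `(l', k')` are identified when `l' = a + l` and `k = a + k'` for some `a`. -/
def contractedRel (X : Over U) (p p' : L.Sec X × K.Sec X) : Prop :=
  ∃ a : A.obj.obj (op X.left), p'.1 = a +ᵥ p.1 ∧ p.2 = a +ᵥ p'.2

/-- The presheaf quotient of `L × K` by the antidiagonal action of `A`. -/
def contractedPresheaf : (Over U)ᵒᵖ ⥤ Type (max u v) where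
  obj X := Quot (contractedRel L K X.unop)
  map {X Y} g := ↾(Quot.map (fun p => (L.res g.unop p.1, K.res g.unop p.2)) (by
    rintro p p' ⟨a, h₁, h₂⟩
    refine ⟨resAb A g.unop.left a, ?_, ?_⟩
    · rw [h₁, res_vadd]
    · rw [h₂, res_vadd]))
  map_id X := by
    ext p
    induction p using Quot.ind with
    | mk p =>
      change Quot.mk _ _ = Quot.mk _ _
      simp [res_id]
  map_comp {X Y Z} g h := by
    ext p
    induction p using Quot.ind with
    | mk p =>
      change Quot.mk _ _ = Quot.mk _ _
      simp [res_comp]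

/-- The sheaf of sets underlying the contracted product: the quotient sheaf of `L × K` by the
antidiagonal action of `A`, that is, the sheaf associated to `contractedPresheaf`. -/
noncomputable def contractedSheaf : Sheaf (J.over U) (Type (max u v)) :=
  (presheafToSheaf (J.over U) (Type (max u v))).obj (contractedPresheaf L K)

/-- The class of `(l, k)` in the contracted product. -/
noncomputable def pair {X : Over U} (l : L.Sec X) (k : K.Sec X) :
    (contractedSheaf L K).obj.obj (op X) :=
  (toSheafify (J.over U) (contractedPresheaf L K)).app (op X) (Quot.mk _ (l, k))

theorem map_pair {X Y : Over U} (g : Y ⟶ X) (l : L.Sec X) (k : K.Sec X) :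
    (contractedSheaf L K).obj.map g.op (pair L K l k) = pair L K (L.res g l) (K.res g k) := by
  have := congrArg (fun f => f (Quot.mk _ (l, k)))
    ((toSheafify (J.over U) (contractedPresheaf L K)).naturality g.op)
  exact this.symm

theorem pair_vadd {X : Over U} (a : A.obj.obj (op X.left)) (l : L.Sec X) (k : K.Sec X) :
    pair L K (a +ᵥ l) k = pair L K l (a +ᵥ k) := by
  unfold pair
  congr 1
  exact (Quot.sound ⟨a, rfl, rfl⟩).symm

theorem contractedRel_equiv (X : Over U) : Equivalence (contractedRel L K X) where
  refl p := ⟨0, by simp, by simp⟩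
  symm := by
    rintro p p' ⟨a, h₁, h₂⟩
    exact ⟨-a, by simp [h₁], by simp [h₂]⟩
  trans := by
    rintro p p' p'' ⟨a, h₁, h₂⟩ ⟨b, h₃, h₄⟩
    exact ⟨b + a, by simp [h₁, h₃, add_vadd], by rw [h₂, h₄, add_comm, add_vadd]⟩

theorem pair_eq {X : Over U} {l l' : L.Sec X} {k k' : K.Sec X}
    (h : pair L K l k = pair L K l' k') :
    ∃ a : A.obj.obj (op X.left), l' = a +ᵥ l ∧ k = a +ᵥ k' := by
  have hS := Presheaf.equalizerSieve_mem (J.over U)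
    (toSheafify (J.over U) (contractedPresheaf L K)) (X := op X) _ _ h
  obtain ⟨a, ha⟩ := L.exists_vadd l l'
  refine ⟨a, ha, ?_⟩
  refine K.sec_ext _ _ ⟨_, hS, fun Y g hg => ?_⟩
  have hg' : (Quot.mk (contractedRel L K Y) (L.res g l, K.res g k)) =
    Quot.mk (contractedRel L K Y) (L.res g l', K.res g k') := hg
  rw [(contractedRel_equiv L K Y).quot_mk_eq_iff] at hg'
  obtain ⟨b, hb, hb'⟩ := hg'
  simp only at hb hb'
  rw [ha, res_vadd] at hb
  rw [hb', res_vadd, L.vadd_inj hb]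

theorem exists_pair {X : Over U} (p : (contractedSheaf L K).obj.obj (op X)) :
    ∃ S ∈ J.over U X, ∀ ⦃Y : Over U⦄ (g : Y ⟶ X), S g →
      ∃ (l : L.Sec Y) (k : K.Sec Y), (contractedSheaf L K).obj.map g.op p = pair L K l k := by
  refine ⟨_, Presheaf.imageSieve_mem (J.over U)
    (toSheafify (J.over U) (contractedPresheaf L K)) (U := op X) p, fun Y g hg => ?_⟩
  obtain ⟨t, ht⟩ := hg
  induction t using Quot.ind with
  | mk t => exact ⟨t.1, t.2, ht.symm⟩

/-- `r` is the translate of `p` by `a`: on representatives, `a + (l, k) = (a + l, k)`. -/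
def IsTranslate {X : Over U} (a : A.obj.obj (op X.left))
    (p r : (contractedSheaf L K).obj.obj (op X)) : Prop :=
  ∀ ⦃Y : Over U⦄ (g : Y ⟶ X) (l : L.Sec Y) (k : K.Sec Y),
    (contractedSheaf L K).obj.map g.op p = pair L K l k →
      (contractedSheaf L K).obj.map g.op r = pair L K (resAb A g.left a +ᵥ l) k

theorem isTranslate_pair {X : Over U} (a : A.obj.obj (op X.left)) (l : L.Sec X) (k : K.Sec X) :
    IsTranslate L K a (pair L K l k) (pair L K (a +ᵥ l) k) := by
  intro Y g l' k' h
  rw [map_pair] at h ⊢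
  obtain ⟨b, h₁, h₂⟩ := pair_eq L K h
  rw [h₁, h₂, ← pair_vadd, res_vadd, ← add_vadd, ← add_vadd, add_comm]

theorem isTranslate_unique {X : Over U} {a : A.obj.obj (op X.left)}
    {p r r' : (contractedSheaf L K).obj.obj (op X)} (h : IsTranslate L K a p r)
    (h' : IsTranslate L K a p r') : r = r' := by
  obtain ⟨S, hS, hp⟩ := exists_pair L K p
  refine eq_of_locally_eq (contractedSheaf L K).property _ _ ⟨S, hS, fun Y g hg => ?_⟩
  obtain ⟨l, k, hlk⟩ := hp g hg
  rw [h g l k hlk, h' g l k hlk]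

theorem IsTranslate.res {X Y : Over U} (g : Y ⟶ X) {a : A.obj.obj (op X.left)}
    {p r : (contractedSheaf L K).obj.obj (op X)} (h : IsTranslate L K a p r) :
    IsTranslate L K (resAb A g.left a) ((contractedSheaf L K).obj.map g.op p)
      ((contractedSheaf L K).obj.map g.op r) := by
  intro Z f l k hlk
  have := h (f ≫ g) l k (by simpa using hlk)
  rw [← resAb_comp]
  simpa using this

theorem isTranslate_of_local {X : Over U} {a : A.obj.obj (op X.left)}
    {p r : (contractedSheaf L K).obj.obj (op X)}
    (h : ∃ S ∈ J.over U X, ∀ ⦃Y : Over U⦄ (g : Y ⟶ X), S g →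
      IsTranslate L K (resAb A g.left a) ((contractedSheaf L K).obj.map g.op p)
        ((contractedSheaf L K).obj.map g.op r)) : IsTranslate L K a p r := by
  obtain ⟨S, hS, h⟩ := h
  intro Y g l k hlk
  refine eq_of_locally_eq (contractedSheaf L K).property _ _
    ⟨_, (J.over U).pullback_stable g hS, fun Z f hf => ?_⟩
  have := h (f ≫ g) hf (𝟙 Z) (L.res f l) (K.res f k) (by
    have := congrArg ((contractedSheaf L K).obj.map f.op) hlk
    rw [map_pair] at this
    simpa using this)
  rw [map_pair, res_vadd, ← resAb_comp]
  rw [Over.id_left, resAb_id] at this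
  simpa using this

theorem exists_isTranslate {X : Over U} (a : A.obj.obj (op X.left))
    (p : (contractedSheaf L K).obj.obj (op X)) : ∃ r, IsTranslate L K a p r := by
  obtain ⟨S, hS, hp⟩ := exists_pair L K p
  obtain ⟨r, hr⟩ := exists_of_locally_existsUnique (contractedSheaf L K).property
    (X := X) (fun {Y} g r => IsTranslate L K (resAb A g.left a)
      ((contractedSheaf L K).obj.map g.op p) r)
    (fun g h r hr => by
      rw [Over.comp_left, resAb_comp]
      simpa using hr.res L K h)
    (fun g r r' h h' => isTranslate_unique L K h h') S hS
    (fun Y g hg => by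
      obtain ⟨l, k, hlk⟩ := hp g hg
      exact ⟨_, hlk ▸ isTranslate_pair L K _ l k⟩)
  exact ⟨r, isTranslate_of_local L K ⟨S, hS, hr⟩⟩

/-- The action of `A` on the contracted product, determined by `a + (l, k) = (a + l, k)`. -/
noncomputable def contractedVAdd {X : Over U} (a : A.obj.obj (op X.left))
    (p : (contractedSheaf L K).obj.obj (op X)) : (contractedSheaf L K).obj.obj (op X) :=
  (exists_isTranslate L K a p).choose

theorem contractedVAdd_spec {X : Over U} (a : A.obj.obj (op X.left))
    (p : (contractedSheaf L K).obj.obj (op X)) :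
    IsTranslate L K a p (contractedVAdd L K a p) :=
  (exists_isTranslate L K a p).choose_spec

theorem contractedVAdd_pair {X : Over U} (a : A.obj.obj (op X.left)) (l : L.Sec X)
    (k : K.Sec X) : contractedVAdd L K a (pair L K l k) = pair L K (a +ᵥ l) k :=
  isTranslate_unique L K (contractedVAdd_spec L K a _) (isTranslate_pair L K a l k)

theorem map_contractedVAdd {X Y : Over U} (g : Y ⟶ X) (a : A.obj.obj (op X.left))
    (p : (contractedSheaf L K).obj.obj (op X)) :
    (contractedSheaf L K).obj.map g.op (contractedVAdd L K a p) =
      contractedVAdd L K (resAb A g.left a) ((contractedSheaf L K).obj.map g.op p) :=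
  isTranslate_unique L K ((contractedVAdd_spec L K a p).res L K g) (contractedVAdd_spec L K _ _)

/-- The contracted product `L ∧ K` over `A`. -/
noncomputable def contracted : ATorsor A U where
  sheaf := contractedSheaf L K
  action X :=
    { vadd := contractedVAdd L K
      zero_vadd := fun p => by
        change contractedVAdd L K 0 p = p
        refine isTranslate_unique L K (contractedVAdd_spec L K 0 p) (fun Y g l k h => ?_)
        simpa using h
      add_vadd := fun a b p => by
        change contractedVAdd L K (a + b) p = contractedVAdd L K a (contractedVAdd L K b p)
        refine isTranslate_unique L K (contractedVAdd_spec L K _ p) (fun Y g l k h => ?_)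
        rw [map_contractedVAdd, map_contractedVAdd, h, contractedVAdd_pair, contractedVAdd_pair,
          map_add, add_vadd] }
  map_vadd g a l := map_contractedVAdd L K g a l
  existsUnique_vadd X p p' := by
    have huniq : ∀ {Y : Over U} (a a' : A.obj.obj (op Y.left))
        (p : (contractedSheaf L K).obj.obj (op Y)),
        contractedVAdd L K a p = contractedVAdd L K a' p → a = a' := by
      intro Y a a' p h
      obtain ⟨S, hS, hp⟩ := exists_pair L K p
      refine ab_ext a a' ⟨S, hS, fun Z g hg => ?_⟩
      obtain ⟨l, k, hlk⟩ := hp g hg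
      have h' := congrArg ((contractedSheaf L K).obj.map g.op) h
      rw [map_contractedVAdd, map_contractedVAdd, hlk, contractedVAdd_pair,
        contractedVAdd_pair] at h'
      obtain ⟨b, hb, hb'⟩ := pair_eq L K h'
      have hb0 : b = 0 := (K.vadd_inj (a := b) (a' := 0) (l := k) (by rw [← hb', zero_vadd]))
      rw [hb0, zero_vadd] at hb
      exact (L.vadd_inj hb).symm
    obtain ⟨S, hS, hp⟩ := exists_pair L K p
    obtain ⟨S', hS', hp'⟩ := exists_pair L K p'
    obtain ⟨a, ha⟩ := ab_exists (X := X)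
      (fun {Y} g (a : A.obj.obj (op Y.left)) =>
        contractedVAdd L K a ((contractedSheaf L K).obj.map g.op p) =
          (contractedSheaf L K).obj.map g.op p')
      (fun {Y Z} g h a ha => by
        have := congrArg ((contractedSheaf L K).obj.map h.op) ha
        rw [map_contractedVAdd] at this
        simpa using this)
      (fun g a a' h h' => huniq a a' _ (h.trans h'.symm)) (S ⊓ S')
      ((J.over U).intersection_covering hS hS') (fun Y g hg => by
        obtain ⟨l, k, hlk⟩ := hp g hg.1
        obtain ⟨l', k', hlk'⟩ := hp' g hg.2
        obtain ⟨b, rfl⟩ := L.exists_vadd l l'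
        obtain ⟨c, rfl⟩ := K.exists_vadd k k'
        refine ⟨c + b, ?_⟩
        rw [hlk, hlk', contractedVAdd_pair, ← pair_vadd, add_vadd])
    have hap : contractedVAdd L K a p = p' :=
      eq_of_locally_eq (contractedSheaf L K).property _ _
        ⟨S ⊓ S', (J.over U).intersection_covering hS hS', fun Y g hg =>
          (map_contractedVAdd L K g a p).trans (ha g hg)⟩
    exact ⟨a, hap, fun a' ha' => huniq a' a p (Eq.trans ha' hap.symm)⟩
  locally_nonempty X := by
    obtain ⟨S, hS, h⟩ := L.locally_nonempty X
    obtain ⟨S', hS', h'⟩ := K.locally_nonempty X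
    refine ⟨S ⊓ S', (J.over U).intersection_covering hS hS', fun Y g hg => ?_⟩
    obtain ⟨l⟩ := h g hg.1
    obtain ⟨k⟩ := h' g hg.2
    exact ⟨pair L K l k⟩

end ATorsor

/-! ### `(A, B)`-torsors -/

/-- An `(A, B)`-torsor over `U`: an `A`-torsor `L` over `U` together with an `A`-equivariant
morphism of sheaves `x : L → B`, where `A` acts on `B` through `lam : A ⟶ B`. -/
structure ABTorsor (lam : A ⟶ B) (U : C) extends ATorsor A U where
  toB (X : Over U) : toATorsor.Sec X → B.obj.obj (op X.left)
  toB_res {X Y : Over U} (g : Y ⟶ X) (l : toATorsor.Sec X) :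
    toB Y (toATorsor.res g l) = resAb B g.left (toB X l)
  toB_vadd {X : Over U} (a : A.obj.obj (op X.left)) (l : toATorsor.Sec X) :
    toB X (a +ᵥ l) = onSections lam X.left a + toB X l

theorem onSections_res (lam : A ⟶ B) {X Y : C} (g : Y ⟶ X) (a : A.obj.obj (op X)) :
    onSections lam Y (resAb A g a) = resAb B g (onSections lam X a) :=
  congrArg (fun f => f.hom a) (lam.hom.naturality g.op)

namespace ABTorsor

variable {lam : A ⟶ B} {U : C}

/-- A morphism of `(A, B)`-torsors: an `A`-equivariant morphism of sheaves over `B`. -/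
@[ext]
structure Hom (T R : ABTorsor lam U) where
  app (X : Over U) : T.Sec X → R.Sec X
  app_res {X Y : Over U} (g : Y ⟶ X) (l : T.Sec X) : app Y (T.res g l) = R.res g (app X l)
  app_vadd {X : Over U} (a : A.obj.obj (op X.left)) (l : T.Sec X) :
    app X (a +ᵥ l) = a +ᵥ app X l
  toB_app {X : Over U} (l : T.Sec X) : R.toB X (app X l) = T.toB X l

instance : Category (ABTorsor lam U) where
  Hom T R := Hom T R
  id T :=
    { app := fun X l => l
      app_res := fun _ _ => rfl
      app_vadd := fun _ _ => rfl
      toB_app := fun _ => rfl }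
  comp ψ χ :=
    { app := fun X l => χ.app X (ψ.app X l)
      app_res := fun g l => by rw [ψ.app_res, χ.app_res]
      app_vadd := fun a l => by rw [ψ.app_vadd, χ.app_vadd]
      toB_app := fun l => by rw [χ.toB_app, ψ.toB_app] }

/-- The map on sections of a morphism of `(A, B)`-torsors. -/
def ap {T R : ABTorsor lam U} (ψ : T ⟶ R) {X : Over U} (l : T.Sec X) : R.Sec X :=
  Hom.app ψ X l

section

variable {T R Q : ABTorsor lam U}

theorem ap_id {X : Over U} (l : T.Sec X) : ap (𝟙 T) l = l := rfl

theorem ap_comp (ψ : T ⟶ R) (χ : R ⟶ Q) {X : Over U} (l : T.Sec X) :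
    ap (ψ ≫ χ) l = ap χ (ap ψ l) := rfl

theorem ap_res (ψ : T ⟶ R) {X Y : Over U} (g : Y ⟶ X) (l : T.Sec X) :
    ap ψ (T.res g l) = R.res g (ap ψ l) := Hom.app_res ψ g l

theorem ap_vadd (ψ : T ⟶ R) {X : Over U} (a : A.obj.obj (op X.left)) (l : T.Sec X) :
    ap ψ (a +ᵥ l) = a +ᵥ ap ψ l := Hom.app_vadd ψ a l

theorem toB_ap (ψ : T ⟶ R) {X : Over U} (l : T.Sec X) : R.toB X (ap ψ l) = T.toB X l :=
  Hom.toB_app ψ l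

theorem hom_ext (ψ χ : T ⟶ R) (h : ∀ (X : Over U) (l : T.Sec X), ap ψ l = ap χ l) : ψ = χ :=
  Hom.ext (funext fun X => funext fun l => h X l)

/-- Morphisms of torsors that locally agree on some section are equal. -/
theorem hom_ext_local (ψ χ : T ⟶ R)
    (h : ∀ X : Over U, ∃ S ∈ J.over U X, ∀ ⦃Y : Over U⦄ (g : Y ⟶ X), S g →
      ∃ l : T.Sec Y, ap ψ l = ap χ l) : ψ = χ := by
  refine hom_ext _ _ fun X l => R.sec_ext _ _ ?_
  obtain ⟨S, hS, h⟩ := h X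
  refine ⟨S, hS, fun Y g hg => ?_⟩
  obtain ⟨l', hl'⟩ := h g hg
  obtain ⟨a, ha⟩ := T.exists_vadd l' (T.res g l)
  rw [← ap_res, ← ap_res, ha, ap_vadd, ap_vadd, hl']

/-- A morphism of torsors can be prescribed on local generators. -/
theorem exists_hom (E : Over U → Type (max u v)) (q : ∀ {X : Over U}, E X → T.Sec X)
    (f : ∀ {X : Over U}, E X → R.Sec X)
    (loc : ∀ X : Over U, ∃ S ∈ J.over U X, ∀ ⦃Y : Over U⦄ (g : Y ⟶ X), S g → Nonempty (E Y))
    (compat : ∀ {Y Z : Over U} (h : Z ⟶ Y) (e : E Y) (e' : E Z) (a : A.obj.obj (op Z.left)),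
      q e' = a +ᵥ T.res h (q e) → f e' = a +ᵥ R.res h (f e))
    (hB : ∀ {X : Over U} (e : E X), R.toB X (f e) = T.toB X (q e)) :
    ∃ ψ : T ⟶ R, ∀ (X : Over U) (e : E X), ap ψ (q e) = f e := by
  let Im {X : Over U} (p : T.Sec X) (r : R.Sec X) : Prop :=
    ∀ ⦃Z : Over U⦄ (h : Z ⟶ X) (e : E Z) (a : A.obj.obj (op Z.left)),
      T.res h p = a +ᵥ q e → R.res h r = a +ᵥ f e
  have im_unique : ∀ {X : Over U} (p : T.Sec X) (r r' : R.Sec X), Im p r → Im p r' → r = r' := by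
    intro X p r r' h h'
    obtain ⟨S, hS, hE⟩ := loc X
    refine R.sec_ext _ _ ⟨S, hS, fun Y g hg => ?_⟩
    obtain ⟨e⟩ := hE g hg
    obtain ⟨a, ha⟩ := T.exists_vadd (q e) (T.res g p)
    rw [h g e a ha, h' g e a ha]
  have im_res : ∀ {X Y : Over U} (g : Y ⟶ X) (p : T.Sec X) (r : R.Sec X), Im p r →
      Im (T.res g p) (R.res g r) := by
    intro X Y g p r h Z k e a ha
    rw [← T.res_comp] at ha
    rw [← R.res_comp]
    exact h _ e a ha
  have im_gen : ∀ {X : Over U} (e : E X) (a : A.obj.obj (op X.left)),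
      Im (a +ᵥ q e) (a +ᵥ f e) := by
    intro X e a Z h e' a' ha
    rw [T.res_vadd] at ha
    have := compat h e e' (-a' + resAb A h.left a) (by rw [add_vadd, ha, neg_vadd_vadd])
    rw [this, R.res_vadd, add_vadd, vadd_neg_vadd]
  have im_local : ∀ {X : Over U} (p : T.Sec X) (r : R.Sec X) (S : Sieve X), S ∈ J.over U X →
      (∀ ⦃Y : Over U⦄ (g : Y ⟶ X), S g → Im (T.res g p) (R.res g r)) → Im p r := by
    intro X p r S hS h Z k e a ha
    refine R.sec_ext _ _ ⟨_, (J.over U).pullback_stable k hS, fun Y g hg => ?_⟩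
    have h1 := h (g ≫ k) hg
    rw [T.res_comp, R.res_comp, ha, T.res_vadd] at h1
    obtain ⟨S', hS', hE⟩ := loc Y
    refine R.sec_ext _ _ ⟨S', hS', fun W m hm => ?_⟩
    obtain ⟨e'⟩ := hE m hm
    obtain ⟨b, hb⟩ := T.exists_vadd (q e') (T.res m (resAb A g.left a +ᵥ T.res g (q e)))
    rw [h1 m e' b hb]
    have h2 := im_gen e a (m ≫ g) e' b (by
      rw [T.res_comp, T.res_vadd, hb])
    rw [← h2, R.res_comp]
  have im_exists : ∀ {X : Over U} (p : T.Sec X), ∃ r : R.Sec X, Im p r := by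
    intro X p
    obtain ⟨S, hS, hE⟩ := loc X
    obtain ⟨r, hr⟩ := exists_of_locally_existsUnique R.sheaf.property (X := X)
      (fun {Y} g r => Im (T.res g p) r)
      (fun g h r hr => by rw [T.res_comp]; exact im_res h _ _ hr)
      (fun g r r' h h' => im_unique _ r r' h h') S hS
      (fun Y g hg => by
        obtain ⟨e⟩ := hE g hg
        obtain ⟨a, ha⟩ := T.exists_vadd (q e) (T.res g p)
        exact ⟨a +ᵥ f e, ha ▸ im_gen e a⟩)
    exact ⟨r, im_local p r S hS hr⟩
  choose F hF using @im_exists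
  refine ⟨Hom.mk (fun X p => F p) ?_ ?_ ?_, ?_⟩
  · intro X Y g p
    exact im_unique _ _ _ (hF _) (im_res g _ _ (hF p))
  · intro X a p
    refine im_unique _ _ _ (hF _) ?_
    intro Z h e b hb
    rw [T.res_vadd] at hb
    rw [R.res_vadd, hF p h e (-(resAb A h.left a) + b) (by rw [add_vadd, ← hb, neg_vadd_vadd]),
      add_vadd, vadd_neg_vadd]
  · intro X p
    obtain ⟨S, hS, hE⟩ := loc X
    refine ab_ext _ _ ⟨S, hS, fun Y g hg => ?_⟩
    obtain ⟨e⟩ := hE g hg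
    obtain ⟨a, ha⟩ := T.exists_vadd (q e) (T.res g p)
    rw [← R.toB_res, hF p g e a ha, ← T.toB_res, ha, R.toB_vadd, T.toB_vadd, hB]
  · intro X e
    refine im_unique _ _ _ (hF _) ?_
    have := im_gen e 0
    rwa [zero_vadd, zero_vadd] at this

end

/-! ### The tensor product of `(A, B)`-torsors -/

/-- The class of `(l, k)` as a section of the contracted product. -/
noncomputable def pr {L K : ATorsor A U} {X : Over U} (l : L.Sec X) (k : K.Sec X) :
    (L.contracted K).Sec X := ATorsor.pair L K l k

section

variable {L K : ATorsor A U}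

theorem res_pr {X Y : Over U} (g : Y ⟶ X) (l : L.Sec X) (k : K.Sec X) :
    (L.contracted K).res g (pr l k) = pr (L.res g l) (K.res g k) := ATorsor.map_pair L K g l k

theorem vadd_pr {X : Over U} (a : A.obj.obj (op X.left)) (l : L.Sec X) (k : K.Sec X) :
    a +ᵥ pr l k = pr (a +ᵥ l) k := ATorsor.contractedVAdd_pair L K a l k

theorem pr_vadd_vadd {X : Over U} (a b : A.obj.obj (op X.left)) (l : L.Sec X) (k : K.Sec X) :
    pr (a +ᵥ l) (b +ᵥ k) = (a + b) +ᵥ pr l k := by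
  have : pr (a +ᵥ l) (b +ᵥ k) = pr (b +ᵥ a +ᵥ l) k := (ATorsor.pair_vadd L K b (a +ᵥ l) k).symm
  rw [this, vadd_pr, ← add_vadd, add_comm]

theorem exists_pr {X : Over U} (p : (L.contracted K).Sec X) :
    ∃ S ∈ J.over U X, ∀ ⦃Y : Over U⦄ (g : Y ⟶ X), S g →
      ∃ (l : L.Sec Y) (k : K.Sec Y), (L.contracted K).res g p = pr l k :=
  ATorsor.exists_pair L K p

end

variable (T T' : ABTorsor lam U)

theorem exists_toB {X : Over U} (p : (T.contracted T'.toATorsor).Sec X) :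
    ∃! b : B.obj.obj (op X.left), ∀ ⦃Y : Over U⦄ (g : Y ⟶ X) (l : T.Sec Y) (k : T'.Sec Y),
      (T.contracted T'.toATorsor).res g p = pr l k →
        resAb B g.left b = T.toB Y l + T'.toB Y k := by
  have key : ∀ {Y : Over U} (l l₁ : T.Sec Y) (k k₁ : T'.Sec Y),
      (pr l k : (T.contracted T'.toATorsor).Sec Y) = pr l₁ k₁ →
        T.toB Y l + T'.toB Y k = T.toB Y l₁ + T'.toB Y k₁ := by
    intro Y l l₁ k k₁ h
    obtain ⟨a, h₁, h₂⟩ := ATorsor.pair_eq _ _ h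
    rw [h₁, h₂, T.toB_vadd, T'.toB_vadd]
    abel
  obtain ⟨S, hS, hp⟩ := exists_pr p
  obtain ⟨b, hb⟩ := ab_exists (A := B) (X := X)
    (fun {Y} g b => ∃ (l : T.Sec Y) (k : T'.Sec Y),
      (T.contracted T'.toATorsor).res g p = pr l k ∧ b = T.toB Y l + T'.toB Y k)
    (by
      rintro Y Z g h b ⟨l, k, hlk, rfl⟩
      refine ⟨T.res h l, T'.res h k, ?_, ?_⟩
      · rw [ATorsor.res_comp, hlk, res_pr]
      · rw [map_add, T.toB_res, T'.toB_res])
    (by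
      rintro Y g b b' ⟨l, k, hlk, rfl⟩ ⟨l', k', hlk', rfl⟩
      exact key _ _ _ _ (hlk.symm.trans hlk'))
    S hS
    (by
      intro Y g hg
      obtain ⟨l, k, hlk⟩ := hp g hg
      exact ⟨_, l, k, hlk, rfl⟩)
  refine ⟨b, ?_, ?_⟩
  · intro Y g l k hlk
    refine ab_ext _ _ ⟨_, (J.over U).pullback_stable g hS, fun Z h hh => ?_⟩
    obtain ⟨l', k', hlk', hb'⟩ := hb (h ≫ g) hh
    rw [← resAb_comp, ← Over.comp_left, hb', map_add, ← T.toB_res, ← T'.toB_res]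
    refine key _ _ _ _ ?_
    rw [← hlk', ATorsor.res_comp, hlk, res_pr]
  · intro b' hb'
    refine ab_ext _ _ ⟨S, hS, fun Y g hg => ?_⟩
    obtain ⟨l, k, hlk, h⟩ := hb g hg
    rw [h, hb' g l k hlk]

/-- The morphism `x ∧ y` from the contracted product to `B`, given by `(l, k) ↦ x(l) + y(k)`. -/
noncomputable def tensorToB (X : Over U) (p : (T.contracted T'.toATorsor).Sec X) :
    B.obj.obj (op X.left) := (exists_toB T T' p).choose

theorem tensorToB_pr {X : Over U} (l : T.Sec X) (k : T'.Sec X) :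
    tensorToB T T' X (pr l k) = T.toB X l + T'.toB X k := by
  have := (exists_toB T T' (pr l k)).choose_spec.1 (𝟙 X) l k (ATorsor.res_id _ _)
  rwa [Over.id_left, resAb_id] at this

theorem tensorToB_res {X Y : Over U} (g : Y ⟶ X) (p : (T.contracted T'.toATorsor).Sec X) :
    tensorToB T T' Y ((T.contracted T'.toATorsor).res g p) =
      resAb B g.left (tensorToB T T' X p) := by
  refine ((exists_toB T T' _).choose_spec.2 _ ?_).symm
  intro Z h l k hlk
  rw [← ATorsor.res_comp] at hlk
  rw [← resAb_comp, ← Over.comp_left]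
  exact (exists_toB T T' p).choose_spec.1 _ l k hlk

/-- The tensor product `(L, x) ⊗ (K, y) = (L ∧ K, x ∧ y)`. -/
noncomputable def tensor : ABTorsor lam U where
  toATorsor := T.contracted T'.toATorsor
  toB := tensorToB T T'
  toB_res g p := tensorToB_res T T' g p
  toB_vadd {X} a p := by
    obtain ⟨S, hS, hp⟩ := exists_pr p
    refine ab_ext _ _ ⟨S, hS, fun Y g hg => ?_⟩
    obtain ⟨l, k, hlk⟩ := hp g hg
    rw [← tensorToB_res, ATorsor.res_vadd, map_add, ← tensorToB_res, hlk, vadd_pr, tensorToB_pr,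
      tensorToB_pr, T.toB_vadd, onSections_res, add_assoc]

variable {T T'}

/-- The section `(l, k)` of the tensor product. -/
noncomputable def tmk {X : Over U} (l : T.Sec X) (k : T'.Sec X) : (tensor T T').Sec X := pr l k

theorem res_tmk {X Y : Over U} (g : Y ⟶ X) (l : T.Sec X) (k : T'.Sec X) :
    (tensor T T').res g (tmk l k) = tmk (T.res g l) (T'.res g k) := res_pr g l k

theorem tmk_vadd_vadd {X : Over U} (a b : A.obj.obj (op X.left)) (l : T.Sec X) (k : T'.Sec X) :
    tmk (a +ᵥ l) (b +ᵥ k) = (a + b) +ᵥ tmk l k := pr_vadd_vadd a b l k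

theorem toB_tmk {X : Over U} (l : T.Sec X) (k : T'.Sec X) :
    (tensor T T').toB X (tmk l k) = T.toB X l + T'.toB X k := tensorToB_pr T T' l k

theorem loc₁ (T : ABTorsor lam U) (X : Over U) :
    ∃ S ∈ J.over U X, ∀ ⦃Y : Over U⦄ (g : Y ⟶ X), S g → Nonempty (T.Sec Y) :=
  T.locally_nonempty X

theorem loc₂ (T T' : ABTorsor lam U) (X : Over U) :
    ∃ S ∈ J.over U X, ∀ ⦃Y : Over U⦄ (g : Y ⟶ X), S g → Nonempty (T.Sec Y × T'.Sec Y) := by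
  obtain ⟨S, hS, h⟩ := loc₁ T X
  obtain ⟨S', hS', h'⟩ := loc₁ T' X
  refine ⟨S ⊓ S', (J.over U).intersection_covering hS hS', fun Y g hg => ?_⟩
  obtain ⟨l⟩ := h g hg.1
  obtain ⟨k⟩ := h' g hg.2
  exact ⟨l, k⟩

theorem loc₃ (T T' T'' : ABTorsor lam U) (X : Over U) :
    ∃ S ∈ J.over U X, ∀ ⦃Y : Over U⦄ (g : Y ⟶ X), S g →
      Nonempty (T.Sec Y × T'.Sec Y × T''.Sec Y) := by
  obtain ⟨S, hS, h⟩ := loc₁ T X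
  obtain ⟨S', hS', h'⟩ := loc₂ T' T'' X
  refine ⟨S ⊓ S', (J.over U).intersection_covering hS hS', fun Y g hg => ?_⟩
  obtain ⟨l⟩ := h g hg.1
  obtain ⟨k⟩ := h' g hg.2
  exact ⟨l, k⟩

theorem exists_lift {R : ABTorsor lam U} (f : ∀ {X : Over U}, T.Sec X → T'.Sec X → R.Sec X)
    (f_res : ∀ {X Y : Over U} (g : Y ⟶ X) (l : T.Sec X) (k : T'.Sec X),
      R.res g (f l k) = f (T.res g l) (T'.res g k))
    (f_vadd : ∀ {X : Over U} (a b : A.obj.obj (op X.left)) (l : T.Sec X) (k : T'.Sec X),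
      f (a +ᵥ l) (b +ᵥ k) = (a + b) +ᵥ f l k)
    (f_toB : ∀ {X : Over U} (l : T.Sec X) (k : T'.Sec X),
      R.toB X (f l k) = T.toB X l + T'.toB X k) :
    ∃ ψ : tensor T T' ⟶ R, ∀ (X : Over U) (l : T.Sec X) (k : T'.Sec X),
      ap ψ (tmk l k) = f l k := by
  obtain ⟨ψ, hψ⟩ := exists_hom (T := tensor T T') (R := R) (fun X => T.Sec X × T'.Sec X)
    (fun e => tmk e.1 e.2) (fun e => f e.1 e.2) (loc₂ T T')
    (by
      rintro Y Z h ⟨l, k⟩ ⟨l', k'⟩ a ha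
      dsimp only at ha ⊢
      rw [res_tmk] at ha
      rw [f_res]
      obtain ⟨b, rfl⟩ := T.exists_vadd (T.res h l) l'
      obtain ⟨c, rfl⟩ := T'.exists_vadd (T'.res h k) k'
      rw [tmk_vadd_vadd] at ha
      rw [f_vadd, (tensor T T').vadd_inj ha])
    (fun e => by rw [f_toB, toB_tmk])
  exact ⟨ψ, fun X l k => hψ X (l, k)⟩

theorem exists_tensorHom {T T' R R' : ABTorsor lam U} (ψ : T ⟶ R) (χ : T' ⟶ R') :
    ∃ ω : tensor T T' ⟶ tensor R R', ∀ (X : Over U) (l : T.Sec X) (k : T'.Sec X),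
      ap ω (tmk l k) = tmk (ap ψ l) (ap χ k) :=
  exists_lift (fun l k => tmk (ap ψ l) (ap χ k))
    (fun g l k => by rw [res_tmk, ap_res, ap_res])
    (fun a b l k => by rw [ap_vadd, ap_vadd, tmk_vadd_vadd])
    (fun l k => by rw [toB_tmk, toB_ap, toB_ap])

/-- The morphism `ψ ∧ χ`, `(l, k) ↦ (ψ(l), χ(k))`. -/
noncomputable def tensorHom {T T' R R' : ABTorsor lam U} (ψ : T ⟶ R) (χ : T' ⟶ R') :
    tensor T T' ⟶ tensor R R' := (exists_tensorHom ψ χ).choose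

theorem ap_tensorHom {T T' R R' : ABTorsor lam U} (ψ : T ⟶ R) (χ : T' ⟶ R') {X : Over U}
    (l : T.Sec X) (k : T'.Sec X) :
    ap (tensorHom ψ χ) (tmk l k) = tmk (ap ψ l) (ap χ k) :=
  (exists_tensorHom ψ χ).choose_spec X l k

theorem exists_braiding (T T' : ABTorsor lam U) :
    ∃ ω : tensor T T' ⟶ tensor T' T, ∀ (X : Over U) (l : T.Sec X) (k : T'.Sec X),
      ap ω (tmk l k) = tmk k l :=
  exists_lift (fun l k => tmk k l)
    (fun g l k => by rw [res_tmk])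
    (fun a b l k => by rw [tmk_vadd_vadd, add_comm])
    (fun l k => by rw [toB_tmk, add_comm])

/-- The commutativity constraint `(l, k) ↦ (k, l)`. -/
noncomputable def braiding (T T' : ABTorsor lam U) : tensor T T' ⟶ tensor T' T :=
  (exists_braiding T T').choose

theorem ap_braiding (T T' : ABTorsor lam U) {X : Over U} (l : T.Sec X) (k : T'.Sec X) :
    ap (braiding T T') (tmk l k) = tmk k l := (exists_braiding T T').choose_spec X l k

theorem exists_assocHom (T T' T'' : ABTorsor lam U) :
    ∃ ψ : tensor (tensor T T') T'' ⟶ tensor T (tensor T' T''),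
      ∀ (X : Over U) (l : T.Sec X) (k : T'.Sec X) (m : T''.Sec X),
        ap ψ (tmk (tmk l k) m) = tmk l (tmk k m) := by
  obtain ⟨ψ, hψ⟩ := exists_hom (T := tensor (tensor T T') T'') (R := tensor T (tensor T' T''))
    (fun X => T.Sec X × T'.Sec X × T''.Sec X)
    (fun e => tmk (tmk e.1 e.2.1) e.2.2) (fun e => tmk e.1 (tmk e.2.1 e.2.2)) (loc₃ T T' T'')
    (by
      rintro Y Z h ⟨l, k, m⟩ ⟨l', k', m'⟩ a ha
      dsimp only at ha ⊢
      rw [res_tmk, res_tmk] at ha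
      rw [res_tmk, res_tmk]
      obtain ⟨b, rfl⟩ := T.exists_vadd (T.res h l) l'
      obtain ⟨c, rfl⟩ := T'.exists_vadd (T'.res h k) k'
      obtain ⟨d, rfl⟩ := T''.exists_vadd (T''.res h m) m'
      rw [tmk_vadd_vadd, tmk_vadd_vadd] at ha
      rw [tmk_vadd_vadd, tmk_vadd_vadd, ← add_assoc, ATorsor.vadd_inj _ ha])
    (fun e => by rw [toB_tmk, toB_tmk, toB_tmk, toB_tmk, add_assoc])
  exact ⟨ψ, fun X l k m => hψ X (l, k, m)⟩

theorem exists_assocInv (T T' T'' : ABTorsor lam U) :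
    ∃ ψ : tensor T (tensor T' T'') ⟶ tensor (tensor T T') T'',
      ∀ (X : Over U) (l : T.Sec X) (k : T'.Sec X) (m : T''.Sec X),
        ap ψ (tmk l (tmk k m)) = tmk (tmk l k) m := by
  obtain ⟨ψ, hψ⟩ := exists_hom (T := tensor T (tensor T' T'')) (R := tensor (tensor T T') T'')
    (fun X => T.Sec X × T'.Sec X × T''.Sec X)
    (fun e => tmk e.1 (tmk e.2.1 e.2.2)) (fun e => tmk (tmk e.1 e.2.1) e.2.2) (loc₃ T T' T'')
    (by
      rintro Y Z h ⟨l, k, m⟩ ⟨l', k', m'⟩ a ha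
      dsimp only at ha ⊢
      rw [res_tmk, res_tmk] at ha
      rw [res_tmk, res_tmk]
      obtain ⟨b, rfl⟩ := T.exists_vadd (T.res h l) l'
      obtain ⟨c, rfl⟩ := T'.exists_vadd (T'.res h k) k'
      obtain ⟨d, rfl⟩ := T''.exists_vadd (T''.res h m) m'
      rw [tmk_vadd_vadd, tmk_vadd_vadd] at ha
      rw [tmk_vadd_vadd, tmk_vadd_vadd, add_assoc, ATorsor.vadd_inj _ ha])
    (fun e => by rw [toB_tmk, toB_tmk, toB_tmk, toB_tmk, add_assoc])
  exact ⟨ψ, fun X l k m => hψ X (l, k, m)⟩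

/-- The associativity constraint `((l, k), m) ↦ (l, (k, m))`. -/
noncomputable def assocHom (T T' T'' : ABTorsor lam U) :
    tensor (tensor T T') T'' ⟶ tensor T (tensor T' T'') := (exists_assocHom T T' T'').choose

theorem ap_assocHom (T T' T'' : ABTorsor lam U) {X : Over U} (l : T.Sec X) (k : T'.Sec X)
    (m : T''.Sec X) : ap (assocHom T T' T'') (tmk (tmk l k) m) = tmk l (tmk k m) :=
  (exists_assocHom T T' T'').choose_spec X l k m

/-- The inverse `(l, (k, m)) ↦ ((l, k), m)` of the associativity constraint. -/
noncomputable def assocInv (T T' T'' : ABTorsor lam U) :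
    tensor T (tensor T' T'') ⟶ tensor (tensor T T') T'' := (exists_assocInv T T' T'').choose

theorem ap_assocInv (T T' T'' : ABTorsor lam U) {X : Over U} (l : T.Sec X) (k : T'.Sec X)
    (m : T''.Sec X) : ap (assocInv T T' T'') (tmk l (tmk k m)) = tmk (tmk l k) m :=
  (exists_assocInv T T' T'').choose_spec X l k m

theorem assocHom_assocInv (T T' T'' : ABTorsor lam U) :
    assocHom T T' T'' ≫ assocInv T T' T'' = 𝟙 _ := by
  refine hom_ext_local _ _ fun X => ?_
  obtain ⟨S, hS, h⟩ := loc₃ T T' T'' X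
  refine ⟨S, hS, fun Y g hg => ?_⟩
  obtain ⟨l, k, m⟩ := h g hg
  exact ⟨tmk (tmk l k) m, by rw [ap_comp, ap_assocHom, ap_assocInv, ap_id]⟩

theorem assocInv_assocHom (T T' T'' : ABTorsor lam U) :
    assocInv T T' T'' ≫ assocHom T T' T'' = 𝟙 _ := by
  refine hom_ext_local _ _ fun X => ?_
  obtain ⟨S, hS, h⟩ := loc₃ T T' T'' X
  refine ⟨S, hS, fun Y g hg => ?_⟩
  obtain ⟨l, k, m⟩ := h g hg
  exact ⟨tmk l (tmk k m), by rw [ap_comp, ap_assocInv, ap_assocHom, ap_id]⟩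

/-- For `φ : TT → T` and `σ : RR → R`, the morphism `φ ∧ σ : (TR)(TR) → TR`. It is the composite
`(TR)(TR) → ((TR)T)R → (T(RT))R → (T(TR))R → ((TT)R)R → (TT)(RR) → TR` of associativity
constraints, the commutativity constraint `RT → TR`, and `φ` tensored with `σ`. -/
noncomputable def wedge {T R : ABTorsor lam U} (φ : tensor T T ⟶ T) (σ : tensor R R ⟶ R) :
    tensor (tensor T R) (tensor T R) ⟶ tensor T R :=
  assocInv (tensor T R) T R ≫
    tensorHom (assocHom T R T ≫ tensorHom (𝟙 T) (braiding R T) ≫ assocInv T T R) (𝟙 R) ≫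
      assocHom (tensor T T) R R ≫ tensorHom φ σ

theorem ap_wedge {T R : ABTorsor lam U} (φ : tensor T T ⟶ T) (σ : tensor R R ⟶ R)
    {X : Over U} (l l' : T.Sec X) (k k' : R.Sec X) :
    ap (wedge φ σ) (tmk (tmk l k) (tmk l' k')) =
      tmk (ap φ (tmk l l')) (ap σ (tmk k k')) := by
  unfold wedge
  simp only [ap_comp, ap_assocInv, ap_tensorHom, ap_assocHom, ap_braiding, ap_id]

end ABTorsor

/-! ### Restriction along a morphism of the base -/

/-- The restriction of an `A`-torsor over `U` along `f : V ⟶ U`. -/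
def ATorsor.restrict {U V : C} (f : V ⟶ U) (L : ATorsor A U) : ATorsor A V where
  sheaf := (J.overMapPullback (Type (max u v)) f).obj L.sheaf
  action X := L.action ((Over.map f).obj X)
  map_vadd g a l := L.map_vadd ((Over.map f).map g) a l
  existsUnique_vadd X l l' := L.existsUnique_vadd ((Over.map f).obj X) l l'
  locally_nonempty X := by
    obtain ⟨S, hS, h⟩ := L.locally_nonempty ((Over.map f).obj X)
    exact ⟨_, (Over.map f).cover_lift (J.over V) (J.over U) hS,
      fun Y g hg => h ((Over.map f).map g) hg⟩

namespace ABTorsor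

variable {lam : A ⟶ B} {U V W : C}

/-- The restriction of an `(A, B)`-torsor over `U` along `f : V ⟶ U`. -/
def restrict (f : V ⟶ U) (T : ABTorsor lam U) : ABTorsor lam V where
  toATorsor := T.toATorsor.restrict f
  toB X l := T.toB ((Over.map f).obj X) l
  toB_res g l := T.toB_res ((Over.map f).map g) l
  toB_vadd {X} a l := T.toB_vadd (X := (Over.map f).obj X) a l

/-- The restriction of a morphism of `(A, B)`-torsors. -/
def restrictHom (f : V ⟶ U) {T R : ABTorsor lam U} (ψ : T ⟶ R) :
    restrict f T ⟶ restrict f R :=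
  Hom.mk (T := restrict f T) (R := restrict f R) (fun X l => Hom.app ψ ((Over.map f).obj X) l)
    (fun g l => Hom.app_res ψ ((Over.map f).map g) l)
    (fun {X} a l => Hom.app_vadd ψ (X := (Over.map f).obj X) a l)
    (fun {X} l => Hom.toB_app ψ (X := (Over.map f).obj X) l)

/-- A section of `T` over the image of `X` in `C/U`, seen as a section of the restriction. -/
def toRestrict (f : V ⟶ U) (T : ABTorsor lam U) {X : Over V}
    (l : T.Sec ((Over.map f).obj X)) : (restrict f T).Sec X := l

/-- A section of the restriction of `T`, seen as a section of `T`. -/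
def ofRestrict (f : V ⟶ U) (T : ABTorsor lam U) {X : Over V}
    (l : (restrict f T).Sec X) : T.Sec ((Over.map f).obj X) := l

theorem exists_restrictTensor (f : V ⟶ U) (T T' : ABTorsor lam U) :
    ∃ ω : tensor (restrict f T) (restrict f T') ⟶ restrict f (tensor T T'),
      ∀ (X : Over V) (l : (restrict f T).Sec X) (k : (restrict f T').Sec X), ap ω (tmk l k) =
        toRestrict f (tensor T T') (tmk (ofRestrict f T l) (ofRestrict f T' k)) :=
  exists_lift (fun l k => toRestrict f (tensor T T') (tmk (ofRestrict f T l) (ofRestrict f T' k)))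
    (fun g l k => res_tmk (T := T) (T' := T') ((Over.map f).map g) l k)
    (fun {X} a b l k => tmk_vadd_vadd (T := T) (T' := T') (X := (Over.map f).obj X) a b l k)
    (fun {X} l k => toB_tmk (T := T) (T' := T') (X := (Over.map f).obj X) l k)

/-- The comparison `f^*T ∧ f^*T' ⟶ f^*(T ∧ T')`, given by `(l, k) ↦ (l, k)`. -/
noncomputable def restrictTensor (f : V ⟶ U) (T T' : ABTorsor lam U) :
    tensor (restrict f T) (restrict f T') ⟶ restrict f (tensor T T') :=
  (exists_restrictTensor f T T').choose

theorem ap_restrictTensor (f : V ⟶ U) (T T' : ABTorsor lam U) {X : Over V}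
    (l : (restrict f T).Sec X) (k : (restrict f T').Sec X) :
    ap (restrictTensor f T T') (tmk l k) =
      toRestrict f (tensor T T') (tmk (ofRestrict f T l) (ofRestrict f T' k)) :=
  (exists_restrictTensor f T T').choose_spec X l k

end ABTorsor

/-! ### Saavedra units -/

/-- A Saavedra unit over `U`: an `(A, B)`-torsor `(L, x)` over `U` with a morphism of
`(A, B)`-torsors `φ : (L, x) ⊗ (L, x) ⟶ (L, x)`. -/
structure SaavedraUnit (lam : A ⟶ B) (U : C) where
  torsor : ABTorsor lam U
  φ : ABTorsor.tensor torsor torsor ⟶ torsor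

namespace SaavedraUnit

open ABTorsor

variable {lam : A ⟶ B} {U V W : C}

/-- A morphism of Saavedra units: a morphism of `(A, B)`-torsors compatible with the `φ`. -/
@[ext]
structure Hom (E E' : SaavedraUnit lam U) where
  hom : E.torsor ⟶ E'.torsor
  comm : E.φ ≫ hom = tensorHom hom hom ≫ E'.φ

/-- Two morphisms out of a tensor product agree if they do so on the sections `(l, k)`. -/
theorem tensor_hom_ext {T T' R : ABTorsor lam U} (ψ χ : tensor T T' ⟶ R)
    (h : ∀ (X : Over U) (l : T.Sec X) (k : T'.Sec X), ap ψ (tmk l k) = ap χ (tmk l k)) :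
    ψ = χ := by
  refine hom_ext_local _ _ fun X => ?_
  obtain ⟨S, hS, hE⟩ := loc₂ T T' X
  refine ⟨S, hS, fun Y g hg => ?_⟩
  obtain ⟨l, k⟩ := hE g hg
  exact ⟨tmk l k, h Y l k⟩

theorem Hom.ap_comm {E E' : SaavedraUnit lam U} (ψ : Hom E E') {X : Over U}
    (l k : E.torsor.Sec X) :
    ap ψ.hom (ap E.φ (tmk l k)) = ap E'.φ (tmk (ap ψ.hom l) (ap ψ.hom k)) := by
  rw [← ap_comp, ψ.comm, ap_comp, ap_tensorHom]

/-- A morphism of `(A, B)`-torsors which respects `φ` on the sections `(l, k)` is a morphism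
of Saavedra units. -/
def Hom.ofAp {E E' : SaavedraUnit lam U} (ψ : E.torsor ⟶ E'.torsor)
    (h : ∀ (X : Over U) (l k : E.torsor.Sec X),
      ap ψ (ap E.φ (tmk l k)) = ap E'.φ (tmk (ap ψ l) (ap ψ k))) : Hom E E' where
  hom := ψ
  comm := tensor_hom_ext _ _ fun X l k => by
    rw [ap_comp, h, ap_comp, ap_tensorHom]

instance : Category (SaavedraUnit lam U) where
  Hom E E' := Hom E E'
  id E := Hom.ofAp (𝟙 E.torsor) (fun X l k => rfl)
  comp ψ χ := Hom.ofAp (ψ.hom ≫ χ.hom) (fun X l k => by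
    simp only [ap_comp, ψ.ap_comm, χ.ap_comm])

instance {E E' : SaavedraUnit lam U} : Subsingleton (E ⟶ E') where
  allEq ψ χ := by
    refine Hom.ext (hom_ext_local _ _ fun X => ?_)
    obtain ⟨S, hS, h⟩ := loc₁ E.torsor X
    refine ⟨S, hS, fun Y g hg => ?_⟩
    obtain ⟨l⟩ := h g hg
    obtain ⟨c, hc⟩ := E.torsor.exists_vadd l (ap E.φ (tmk l l))
    have hs : ap E.φ (tmk (-c +ᵥ l) (-c +ᵥ l)) = -c +ᵥ l := by
      rw [tmk_vadd_vadd, ap_vadd, hc, ← add_vadd, neg_add_cancel_right]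
    generalize -c +ᵥ l = t at hs
    refine ⟨t, ?_⟩
    have h₁ := Hom.ap_comm ψ t t
    have h₂ := Hom.ap_comm χ t t
    rw [hs] at h₁ h₂
    obtain ⟨d, hd⟩ := E'.torsor.exists_vadd (ap ψ.hom t) (ap χ.hom t)
    rw [hd, tmk_vadd_vadd, ap_vadd, ← h₁] at h₂
    have := E'.torsor.vadd_inj h₂
    have hd0 : d = 0 := by simpa using this
    rw [hd, hd0, zero_vadd]

/-- The tensor product `((L, x), φ) ⊗ ((K, y), σ) = ((L ∧ K, x ∧ y), φ ∧ σ)`. -/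
noncomputable abbrev tensorUnit (E F : SaavedraUnit lam U) : SaavedraUnit lam U where
  torsor := tensor E.torsor F.torsor
  φ := wedge E.φ F.φ

/-- The tensor product `ψ ∧ χ` of morphisms of Saavedra units. -/
noncomputable def tensorUnitHom {E E' F F' : SaavedraUnit lam U} (ψ : E ⟶ E') (χ : F ⟶ F') :
    tensorUnit E F ⟶ tensorUnit E' F' where
  hom := tensorHom (Hom.hom ψ) (Hom.hom χ)
  comm := by
    refine hom_ext_local _ _ fun X => ?_
    obtain ⟨S, hS, h⟩ := loc₂ E.torsor F.torsor X
    refine ⟨S, hS, fun Y g hg => ?_⟩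
    obtain ⟨l, k⟩ := h g hg
    refine ⟨tmk (tmk l k) (tmk l k), ?_⟩
    change ap (tensorHom _ _) (ap (wedge E.φ F.φ) _) = ap (wedge E'.φ F'.φ) (ap (tensorHom _ _) _)
    rw [ap_wedge, ap_tensorHom, ap_tensorHom, ap_tensorHom, ap_wedge, Hom.ap_comm, Hom.ap_comm]

variable (lam U) in
/-- The tensor product of Saavedra units over `U`, as a bifunctor. -/
noncomputable def tensorFunctor :
    SaavedraUnit lam U ⥤ SaavedraUnit lam U ⥤ SaavedraUnit lam U where
  obj E :=
    { obj := fun F => tensorUnit E F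
      map := fun χ => tensorUnitHom (𝟙 E) χ
      map_id := fun _ => Subsingleton.elim _ _
      map_comp := fun _ _ => Subsingleton.elim _ _ }
  map ψ :=
    { app := fun F => tensorUnitHom ψ (𝟙 F)
      naturality := fun _ _ _ => Subsingleton.elim _ _ }
  map_id E := by ext F; exact Subsingleton.elim _ _
  map_comp ψ χ := by ext F; exact Subsingleton.elim _ _

/-- The restriction `(f^*(L, x), f^*φ)` of a Saavedra unit along `f : V ⟶ U`. -/
noncomputable abbrev restrictUnit (f : V ⟶ U) (E : SaavedraUnit lam U) : SaavedraUnit lam V where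
  torsor := restrict f E.torsor
  φ := restrictTensor f E.torsor E.torsor ≫ restrictHom f E.φ

theorem ap_restrictHom (f : V ⟶ U) {T R : ABTorsor lam U} (ψ : T ⟶ R) {X : Over V}
    (l : (restrict f T).Sec X) :
    ap (restrictHom f ψ) l = toRestrict f R (ap ψ (ofRestrict f T l)) := rfl

theorem ap_restrictUnit_φ (f : V ⟶ U) (E : SaavedraUnit lam U) {X : Over V}
    (l k : (restrict f E.torsor).Sec X) :
    ap (restrictUnit f E).φ (tmk l k) =
      toRestrict f E.torsor (ap E.φ (tmk (ofRestrict f E.torsor l) (ofRestrict f E.torsor k))) :=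
  congrArg (fun t => ap (restrictHom f E.φ) t) (ap_restrictTensor f E.torsor E.torsor l k)

/-- The restriction functor on Saavedra units. -/
noncomputable def restrictFunctor (lam : A ⟶ B) (f : V ⟶ U) :
    SaavedraUnit lam U ⥤ SaavedraUnit lam V where
  obj E := restrictUnit f E
  map {E E'} ψ := Hom.ofAp (E := restrictUnit f E) (E' := restrictUnit f E')
    (restrictHom f (Hom.hom ψ)) (fun X l k => by
      rw [ap_restrictUnit_φ]
      exact (Hom.ap_comm ψ (X := (Over.map f).obj X) l k).trans
        (ap_restrictUnit_φ f E' (ap (restrictHom f (Hom.hom ψ)) l)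
          (ap (restrictHom f (Hom.hom ψ)) k)).symm)
  map_id _ := Subsingleton.elim _ _
  map_comp _ _ := Subsingleton.elim _ _

/-- The canonical morphism `id^*T ⟶ T`. -/
def restrictIdHom (T : ABTorsor lam U) : restrict (𝟙 U) T ⟶ T :=
  ABTorsor.Hom.mk (T := restrict (𝟙 U) T) (R := T)
    (fun X l => T.res (Over.homMk (𝟙 X.left) : X ⟶ (Over.map (𝟙 U)).obj X)
      (ofRestrict (𝟙 U) T l))
    (fun {X Y} g l => by
      change T.res _ (T.res ((Over.map (𝟙 U)).map g) (ofRestrict (𝟙 U) T l)) = _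
      rw [← T.res_comp, ← T.res_comp]
      congr 1
      ext
      simp)
    (fun a l => (T.res_vadd _ _ _).trans (congrArg (fun b => b +ᵥ T.res _ _) (resAb_id a)))
    (fun l => (T.toB_res _ _).trans (resAb_id _))

/-- The canonical morphism `T ⟶ id^*T`. -/
def restrictIdInv (T : ABTorsor lam U) : T ⟶ restrict (𝟙 U) T :=
  ABTorsor.Hom.mk (T := T) (R := restrict (𝟙 U) T)
    (fun X l => toRestrict (𝟙 U) T
      (T.res (Over.homMk (𝟙 X.left) : (Over.map (𝟙 U)).obj X ⟶ X) l))
    (fun {X Y} g l => by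
      change T.res _ (T.res g l) = T.res ((Over.map (𝟙 U)).map g) (T.res _ l)
      rw [← T.res_comp, ← T.res_comp]
      congr 1
      ext
      simp)
    (fun a l => (T.res_vadd _ _ _).trans (congrArg (fun b => b +ᵥ T.res _ _) (resAb_id a)))
    (fun l => (T.toB_res _ _).trans (resAb_id _))

/-- The canonical morphism `(gf)^*T ⟶ g^*f^*T`. -/
def restrictCompHom (f : V ⟶ U) (g : W ⟶ V) (T : ABTorsor lam U) :
    restrict (g ≫ f) T ⟶ restrict g (restrict f T) :=
  ABTorsor.Hom.mk (T := restrict (g ≫ f) T) (R := restrict g (restrict f T))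
    (fun X l => toRestrict g (restrict f T) (toRestrict f T
      (T.res (Over.homMk (𝟙 X.left) :
        (Over.map f).obj ((Over.map g).obj X) ⟶ (Over.map (g ≫ f)).obj X)
        (ofRestrict (g ≫ f) T l))))
    (fun {X Y} h l => by
      change T.res _ (T.res ((Over.map (g ≫ f)).map h) (ofRestrict (g ≫ f) T l)) =
        T.res ((Over.map f).map ((Over.map g).map h)) (T.res _ (ofRestrict (g ≫ f) T l))
      rw [← T.res_comp, ← T.res_comp]
      congr 1
      ext
      simp)
    (fun a l => (T.res_vadd _ _ _).trans (congrArg (fun b => b +ᵥ T.res _ _) (resAb_id a)))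
    (fun l => (T.toB_res _ _).trans (resAb_id _))

/-- The canonical morphism `g^*f^*T ⟶ (gf)^*T`. -/
def restrictCompInv (f : V ⟶ U) (g : W ⟶ V) (T : ABTorsor lam U) :
    restrict g (restrict f T) ⟶ restrict (g ≫ f) T :=
  ABTorsor.Hom.mk (T := restrict g (restrict f T)) (R := restrict (g ≫ f) T)
    (fun X l => toRestrict (g ≫ f) T
      (T.res (Over.homMk (𝟙 X.left) :
        (Over.map (g ≫ f)).obj X ⟶ (Over.map f).obj ((Over.map g).obj X))
        (ofRestrict f T (ofRestrict g (restrict f T) l))))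
    (fun {X Y} h l => by
      change T.res _ (T.res ((Over.map f).map ((Over.map g).map h))
          (ofRestrict f T (ofRestrict g (restrict f T) l))) =
        T.res ((Over.map (g ≫ f)).map h)
          (T.res _ (ofRestrict f T (ofRestrict g (restrict f T) l)))
      rw [← T.res_comp, ← T.res_comp]
      congr 1
      ext
      simp)
    (fun a l => (T.res_vadd _ _ _).trans (congrArg (fun b => b +ᵥ T.res _ _) (resAb_id a)))
    (fun l => (T.toB_res _ _).trans (resAb_id _))

/-- `id^*E ≅ E`, naturally in the Saavedra unit `E`. -/
noncomputable def restrictId (lam : A ⟶ B) (U : C) :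
    restrictFunctor lam (𝟙 U) ≅ 𝟭 (SaavedraUnit lam U) :=
  NatIso.ofComponents (fun E =>
    { hom := Hom.ofAp (E := restrictUnit (𝟙 U) E) (E' := E) (restrictIdHom E.torsor)
        (fun X l k => by
          rw [ap_restrictUnit_φ]
          exact ((ap_res E.φ _ _).symm.trans (congrArg (ap E.φ) (res_tmk _ _ _))))
      inv := Hom.ofAp (E := E) (E' := restrictUnit (𝟙 U) E) (restrictIdInv E.torsor)
        (fun X l k => by
          rw [ap_restrictUnit_φ]
          exact ((ap_res E.φ _ _).symm.trans (congrArg (ap E.φ) (res_tmk _ _ _))))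
      hom_inv_id := Subsingleton.elim (α := restrictUnit (𝟙 U) E ⟶ restrictUnit (𝟙 U) E) _ _
      inv_hom_id := Subsingleton.elim (α := E ⟶ E) _ _ })
    (fun _ => Subsingleton.elim (α := (_ : SaavedraUnit lam U) ⟶ _) _ _)

/-- `(gf)^*E ≅ g^*f^*E`, naturally in the Saavedra unit `E`. -/
noncomputable def restrictComp (lam : A ⟶ B) (f : V ⟶ U) (g : W ⟶ V) :
    restrictFunctor lam (g ≫ f) ≅ restrictFunctor lam f ⋙ restrictFunctor lam g :=
  NatIso.ofComponents (fun E =>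
    { hom := Hom.ofAp (E := restrictUnit (g ≫ f) E) (E' := restrictUnit g (restrictUnit f E))
        (restrictCompHom f g E.torsor)
        (fun X l k => by
          rw [ap_restrictUnit_φ, ap_restrictUnit_φ, ap_restrictUnit_φ]
          exact ((ap_res E.φ _ _).symm.trans (congrArg (ap E.φ) (res_tmk _ _ _))))
      inv := Hom.ofAp (E := restrictUnit g (restrictUnit f E)) (E' := restrictUnit (g ≫ f) E)
        (restrictCompInv f g E.torsor)
        (fun X l k => by
          rw [ap_restrictUnit_φ, ap_restrictUnit_φ, ap_restrictUnit_φ]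
          exact ((ap_res E.φ _ _).symm.trans (congrArg (ap E.φ) (res_tmk _ _ _))))
      hom_inv_id := Subsingleton.elim
        (α := restrictUnit (g ≫ f) E ⟶ restrictUnit (g ≫ f) E) _ _
      inv_hom_id := Subsingleton.elim
        (α := restrictUnit g (restrictUnit f E) ⟶ restrictUnit g (restrictUnit f E)) _ _ })
    (fun _ => Subsingleton.elim (α := (_ : SaavedraUnit lam W) ⟶ _) _ _)

end SaavedraUnit

/-- The stack `I(C)` of Saavedra units of `Tors(A, B)`, as a pseudofunctor: it sends `U` to the
category of Saavedra units over `U`, and `f : V ⟶ U` to the restriction along `f`. -/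
noncomputable def unitStack (lam : A ⟶ B) :
    Pseudofunctor (LocallyDiscrete Cᵒᵖ) Cat.{max u v, max (u + 1) (v + 1)} :=
  LocallyDiscrete.mkPseudofunctor
    (fun U => Cat.of (SaavedraUnit lam U.unop))
    (fun f => (SaavedraUnit.restrictFunctor lam f.unop).toCatHom)
    (fun U => Cat.Hom.isoMk (SaavedraUnit.restrictId lam U.unop))
    (fun f g => Cat.Hom.isoMk (SaavedraUnit.restrictComp lam f.unop g.unop))
    (fun {_ _ _ b₃} f g h => by
      ext E
      exact Subsingleton.elim (α := (_ : SaavedraUnit lam b₃.unop) ⟶ _) _ _)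
    (fun {_ b₁} f => by
      ext E
      exact Subsingleton.elim (α := (_ : SaavedraUnit lam b₁.unop) ⟶ _) _ _)
    (fun {_ b₁} f => by
      ext E
      exact Subsingleton.elim (α := (_ : SaavedraUnit lam b₁.unop) ⟶ _) _ _)

/-- The contracted product of Saavedra units, as a bifunctor on the fibre over `U`. -/
noncomputable def unitTensor (lam : A ⟶ B) (U : C) :
    (unitStack lam).obj (.mk (op U)) ⥤ (unitStack lam).obj (.mk (op U)) ⥤
      (unitStack lam).obj (.mk (op U)) :=
  SaavedraUnit.tensorFunctor lam U

end Torsors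

/-! ### Picard stacks -/

section Picard

/-- The action of a bifunctor on a pair of morphisms. -/
abbrev tmap {D : Type u'} [Category.{v'} D] (T : D ⥤ D ⥤ D) {X X' Y Y' : D} (f : X ⟶ X')
    (g : Y ⟶ Y') : (T.obj X).obj Y ⟶ (T.obj X').obj Y' :=
  (T.map f).app Y ≫ (T.obj X').map g

/-- A strictly commutative Picard category with tensor product `T`: a nonempty groupoid in which
tensoring with any object is an equivalence, with associativity and commutativity constraints
satisfying the pentagon and hexagon axioms, such that the commutativity constraint is symmetric
and is the identity on `X ⊗ X`. Units are not part of the data. -/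
structure PicardCategory {D : Type u'} [Category.{v'} D] (T : D ⥤ D ⥤ D) where
  isGroupoid : IsGroupoid D
  nonempty : Nonempty D
  isEquivalence (X : D) : (T.obj X).IsEquivalence
  assoc (X Y Z : D) : (T.obj ((T.obj X).obj Y)).obj Z ≅ (T.obj X).obj ((T.obj Y).obj Z)
  assoc_naturality {X X' Y Y' Z Z' : D} (f : X ⟶ X') (g : Y ⟶ Y') (h : Z ⟶ Z') :
    tmap T (tmap T f g) h ≫ (assoc X' Y' Z').hom = (assoc X Y Z).hom ≫ tmap T f (tmap T g h)
  comm (X Y : D) : (T.obj X).obj Y ≅ (T.obj Y).obj X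
  comm_naturality {X X' Y Y' : D} (f : X ⟶ X') (g : Y ⟶ Y') :
    tmap T f g ≫ (comm X' Y').hom = (comm X Y).hom ≫ tmap T g f
  pentagon (X Y Z W : D) :
    tmap T (assoc X Y Z).hom (𝟙 W) ≫ (assoc X ((T.obj Y).obj Z) W).hom ≫
        tmap T (𝟙 X) (assoc Y Z W).hom =
      (assoc ((T.obj X).obj Y) Z W).hom ≫ (assoc X Y ((T.obj Z).obj W)).hom
  hexagon (X Y Z : D) :
    (assoc X Y Z).hom ≫ (comm X ((T.obj Y).obj Z)).hom ≫ (assoc Y Z X).hom =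
      tmap T (comm X Y).hom (𝟙 Z) ≫ (assoc Y X Z).hom ≫ tmap T (𝟙 Y) (comm X Z).hom
  comm_symm (X Y : D) : (comm X Y).hom ≫ (comm Y X).hom = 𝟙 _
  comm_self (X : D) : (comm X X).hom = 𝟙 _

/-- The structure of an additive functor on a functor `F` between Picard categories: natural
isomorphisms `F X ⊗ F Y ≅ F (X ⊗ Y)` compatible with the constraints. -/
structure AdditiveFunctor {D D' : Type u'} [Category.{v'} D] [Category.{v'} D']
    {T : D ⥤ D ⥤ D} {T' : D' ⥤ D' ⥤ D'} (P : PicardCategory T) (P' : PicardCategory T')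
    (F : D ⥤ D') where
  μ (X Y : D) : (T'.obj (F.obj X)).obj (F.obj Y) ≅ F.obj ((T.obj X).obj Y)
  μ_naturality {X X' Y Y' : D} (f : X ⟶ X') (g : Y ⟶ Y') :
    tmap T' (F.map f) (F.map g) ≫ (μ X' Y').hom = (μ X Y).hom ≫ F.map (tmap T f g)
  μ_assoc (X Y Z : D) :
    tmap T' (μ X Y).hom (𝟙 (F.obj Z)) ≫ (μ ((T.obj X).obj Y) Z).hom ≫
        F.map (P.assoc X Y Z).hom =
      (P'.assoc (F.obj X) (F.obj Y) (F.obj Z)).hom ≫ tmap T' (𝟙 (F.obj X)) (μ Y Z).hom ≫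
        (μ X ((T.obj Y).obj Z)).hom
  μ_comm (X Y : D) :
    (μ X Y).hom ≫ F.map (P.comm X Y).hom = (P'.comm (F.obj X) (F.obj Y)).hom ≫ (μ Y X).hom

/-- The structure of a Picard stack, with tensor product `T`, on a pseudofunctor `F`: `F` is a
stack, its fibres are Picard categories, and its restriction functors are additive, compatibly
with the isomorphisms `id^* ≅ id` and `(gf)^* ≅ g^*f^*`. -/
structure PicardStack {C : Type u} [Category.{v} C] (J : GrothendieckTopology C)
    (F : Pseudofunctor (LocallyDiscrete Cᵒᵖ) Cat.{v', u'})
    (T : ∀ U : C, F.obj (.mk (op U)) ⥤ F.obj (.mk (op U)) ⥤ F.obj (.mk (op U))) where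
  isStack : F.IsStack J
  picard (U : C) : PicardCategory (T U)
  additive {U V : C} (f : V ⟶ U) :
    AdditiveFunctor (picard U) (picard V) (F.map f.op.toLoc).toFunctor
  μ_id (U : C) (X Y : F.obj (.mk (op U))) :
    ((additive (𝟙 U)).μ X Y).hom ≫ (F.mapId (.mk (op U))).hom.toNatTrans.app (((T U).obj X).obj Y) =
      tmap (T U) ((F.mapId (.mk (op U))).hom.toNatTrans.app X)
        ((F.mapId (.mk (op U))).hom.toNatTrans.app Y)
  μ_comp {U V W : C} (f : V ⟶ U) (g : W ⟶ V) (X Y : F.obj (.mk (op U))) :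
    ((additive (g ≫ f)).μ X Y).hom ≫
        (F.mapComp f.op.toLoc g.op.toLoc).hom.toNatTrans.app (((T U).obj X).obj Y) =
      tmap (T W) ((F.mapComp f.op.toLoc g.op.toLoc).hom.toNatTrans.app X)
          ((F.mapComp f.op.toLoc g.op.toLoc).hom.toNatTrans.app Y) ≫
        ((additive g).μ ((F.map f.op.toLoc).toFunctor.obj X)
          ((F.map f.op.toLoc).toFunctor.obj Y)).hom ≫
        (F.map g.op.toLoc).toFunctor.map ((additive f).μ X Y).hom

end Picard

end SaavedraUnits

namespace SaavedraUnits

/-! ### Contractible categories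

A category is contractible when it is nonempty and has exactly one morphism between any two
objects. -/

section Contractible

/-! The stack of Saavedra units is equivalent to the terminal one: every fibre is nonempty and has
exactly one morphism between any two objects. Once this is known, every diagram of morphisms in a
fibre commutes, so pentagon, hexagon, symmetry, strictness, naturality and the compatibilities of
restriction cost nothing, and so does descent. What remains is to produce the constraints as
morphisms of Saavedra units with the prescribed underlying torsor morphisms.

Contractibility comes from idempotent sections. The map `φ` satisfies φ(a + l, b + k) = (a + b) +
φ(l, k), so if φ(l, l) = c + l, then t = -c + l satisfies φ(t, t) = t. Replacing t by a + t gives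
φ(a + t, a + t) = 2a + t, which equals a + t only for a = 0. Hence there is exactly one idempotent
section wherever the torsor has a section at all (`exists_isIdem`, `IsIdem.unique`), and it is
stable under restriction. Since x is additive along `φ`, x(t) + x(t) = x(t), so x(t) = 0
(`IsIdem.toB_eq_zero`).

Sending idempotent to idempotent therefore defines, by gluing, a morphism between any two Saavedra
units (`nonempty_hom`). It is the only one, because a morphism carries idempotents to idempotents
and an equivariant map is determined by one local section. Nonemptiness of the fibres comes from A
itself with addition as `φ`.

The three constraints respect the `φ`'s because `wedge` acts componentwise on pairs, and each
equality of morphisms needs checking only on one section locally. -/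

/-- There is exactly one morphism between any two objects. -/
def UniqueHoms (D : Type u') [Category.{v'} D] : Prop :=
  ∀ X Y : D, Nonempty (Unique (X ⟶ Y))

namespace UniqueHoms

variable {D : Type u'} [Category.{v'} D]

theorem nonempty (h : UniqueHoms D) (X Y : D) : Nonempty (X ⟶ Y) :=
  (h X Y).elim fun i => ⟨i.default⟩

theorem eq (h : UniqueHoms D) {X Y : D} (f g : X ⟶ Y) : f = g :=
  (h X Y).elim fun _ => Subsingleton.elim f g

/-- The isomorphism with given underlying morphism. -/
noncomputable def iso (h : UniqueHoms D) {X Y : D} (f : X ⟶ Y) : X ≅ Y where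
  hom := f
  inv := (h.nonempty Y X).some
  hom_inv_id := h.eq _ _
  inv_hom_id := h.eq _ _

theorem isGroupoid (h : UniqueHoms D) : IsGroupoid D where
  all_isIso f := (h.iso f).isIso_hom

theorem isEquivalence {D' : Type u} [Category.{v} D'] (h : UniqueHoms D) (h' : UniqueHoms D')
    [Nonempty D] (F : D ⥤ D') : F.IsEquivalence where
  faithful := ⟨fun _ => h.eq _ _⟩
  -- Any morphism between the sources is a preimage, since its image is the only morphism available.
  full := ⟨fun {X Y} _ => ⟨(h.nonempty X Y).some, h'.eq _ _⟩⟩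
  essSurj := ⟨fun Y => ⟨Classical.arbitrary D, ⟨h'.iso (h'.nonempty _ Y).some⟩⟩⟩

/-- In a contractible category all coherence conditions hold. -/
noncomputable def picardCategory (h : UniqueHoms D) (hD : Nonempty D) {T : D ⥤ D ⥤ D}
    (assoc : ∀ X Y Z : D, (T.obj ((T.obj X).obj Y)).obj Z ⟶ (T.obj X).obj ((T.obj Y).obj Z))
    (comm : ∀ X Y : D, (T.obj X).obj Y ⟶ (T.obj Y).obj X) : PicardCategory T where
  isGroupoid := h.isGroupoid
  nonempty := hD
  isEquivalence _ := h.isEquivalence h _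
  assoc X Y Z := h.iso (assoc X Y Z)
  assoc_naturality _ _ _ := h.eq _ _
  comm X Y := h.iso (comm X Y)
  comm_naturality _ _ := h.eq _ _
  pentagon _ _ _ _ := h.eq _ _
  hexagon _ _ _ := h.eq _ _
  comm_symm _ _ := h.eq _ _
  comm_self _ := h.eq _ _

end UniqueHoms

/-- A pseudofunctor with contractible fibres is a stack. -/
theorem isStack_of_uniqueHoms {C : Type u} [Category.{v} C] (J : GrothendieckTopology C)
    (F : Pseudofunctor (LocallyDiscrete Cᵒᵖ) Cat.{v', u'})
    (h : ∀ U : C, UniqueHoms (F.obj (.mk (op U)))) (hF : ∀ U : C, Nonempty (F.obj (.mk (op U)))) :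
    F.IsStack J where
  isSheaf {S} M N := by
    rw [isSheaf_iff_isSheaf_of_type]
    intro X R _ x _
    -- Any morphism over the whole object is the gluing: its restrictions agree with the given
    -- family because no other morphisms exist.
    refine ⟨((h _).nonempty _ _).some, fun Y f hf => (h _).eq _ _, fun _ _ => (h _).eq _ _⟩
  essSurj_of_sieve {S} R _ := by
    -- The descended object can be any object over `S`: its restrictions are uniquely isomorphic to
    -- the pieces of the descent datum, and compatibility with the gluing isomorphisms is again an
    -- equality in a one-element set.
    refine ⟨fun D => ⟨(hF S).some, ⟨Pseudofunctor.DescentData.isoMk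
      (fun i => (h _).iso ((h _).nonempty _ _).some) fun _ _ _ _ _ _ _ _ => (h _).eq _ _⟩⟩⟩

end Contractible

/-! ### The fibres of the stack of Saavedra units -/

section Fibres

variable {C : Type u} [Category.{v} C] {J : GrothendieckTopology C}
variable {A B : Sheaf J AddCommGrpCat.{max u v}} {lam : A ⟶ B} {U V : C}

/-- The trivial `(A, B)`-torsor `(A, lam)`. -/
def ABTorsor.trivial (lam : A ⟶ B) (U : C) : ABTorsor lam U where
  sheaf := ⟨_, isSheaf_forget A U⟩
  action X := inferInstanceAs (AddAction (A.obj.obj (op X.left)) (A.obj.obj (op X.left)))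
  map_vadd g a l := map_add (resAb A g.left) a l
  existsUnique_vadd X l l' :=
    -- The group is named explicitly because `l` and `l'` are typed as sections of a sheaf of sets,
    -- where subtraction is not visible.
    ⟨Sub.sub (α := A.obj.obj (op X.left)) l' l,
      sub_add_cancel (G := A.obj.obj (op X.left)) l' l,
      fun _ h => eq_sub_of_add_eq (G := A.obj.obj (op X.left)) h⟩
  locally_nonempty X := ⟨⊤, (J.over U).top_mem X, fun Y _ _ => ⟨(0 : A.obj.obj (op Y.left))⟩⟩
  toB X l := onSections lam X.left l
  toB_res g l := onSections_res lam g.left l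
  toB_vadd {X} a l := map_add (onSections lam X.left) a l

namespace SaavedraUnit

open ABTorsor

/-- The trivial torsor `A` is a Saavedra unit, with `φ(a, b) = a + b`. -/
theorem nonempty (lam : A ⟶ B) (U : C) : Nonempty (SaavedraUnit lam U) := by
  obtain ⟨φ, -⟩ := exists_lift (T := ABTorsor.trivial lam U) (T' := ABTorsor.trivial lam U)
    (R := ABTorsor.trivial lam U)
    (fun {X} l k => Add.add (α := A.obj.obj (op X.left)) l k)
    (fun {X _} g l k => map_add (M := A.obj.obj (op X.left)) (resAb A g.left) l k)
    -- Bi-equivariance of addition, (a + l) + (b + k) = (a + b) + (l + k): the point where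
    -- commutativity of A enters.
    (fun {X} a b l k => add_add_add_comm (G := A.obj.obj (op X.left)) a l b k)
    (fun {X} l k => map_add (M := A.obj.obj (op X.left)) (onSections lam X.left) l k)
  exact ⟨⟨_, φ⟩⟩

/-! ### Idempotent sections and contractibility of the fibres. -/

/-- The idempotent sections of a Saavedra unit: those with `φ(t, t) = t`. -/
def IsIdem (E : SaavedraUnit lam U) {X : Over U} (t : E.torsor.Sec X) : Prop :=
  ap E.φ (tmk t t) = t

variable {E : SaavedraUnit lam U} {X Y : Over U}

theorem IsIdem.res {t : E.torsor.Sec X} (ht : E.IsIdem t) (g : Y ⟶ X) :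
    E.IsIdem (E.torsor.res g t) := by
  unfold IsIdem
  rw [← res_tmk, ap_res, ht]

/-- Translating both arguments of `φ` by a translates its value by 2a, so idempotence of the
translate forces 2a = a. This is the rigidity behind uniqueness of idempotents. -/
theorem IsIdem.eq_zero {t : E.torsor.Sec X} (ht : E.IsIdem t) {a : A.obj.obj (op X.left)}
    (ha : E.IsIdem (a +ᵥ t)) : a = 0 := by
  unfold IsIdem at ha
  rw [tmk_vadd_vadd, ap_vadd, ht] at ha
  simpa using E.torsor.vadd_inj ha

theorem IsIdem.unique {t t' : E.torsor.Sec X} (ht : E.IsIdem t) (ht' : E.IsIdem t') :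
    t = t' := by
  obtain ⟨a, rfl⟩ := E.torsor.exists_vadd t t'
  rw [ht.eq_zero ht', zero_vadd]

/-- Because `φ` lies over B, the value b at an idempotent satisfies b + b = b. This lets idempotents
of different units be matched by a morphism over B. -/
theorem IsIdem.toB_eq_zero {t : E.torsor.Sec X} (ht : E.IsIdem t) : E.torsor.toB X t = 0 := by
  have h := toB_ap E.φ (tmk t t)
  rw [ht, toB_tmk] at h
  simpa using h

/-- A section is needed to start from, so idempotents are obtained here only where the torsor is
known to be nonempty. -/
theorem exists_isIdem (l : E.torsor.Sec X) : ∃ t : E.torsor.Sec X, E.IsIdem t := by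
  obtain ⟨c, hc⟩ := E.torsor.exists_vadd l (ap E.φ (tmk l l))
  -- Translating l by -c changes φ(l, l) = c + l by -2c, which leaves -c + l.
  refine ⟨-c +ᵥ l, ?_⟩
  unfold IsIdem
  rw [tmk_vadd_vadd, ap_vadd, hc, ← add_vadd, neg_add_cancel_right]

/-- Any two Saavedra units are isomorphic, through the isomorphism which identifies their
idempotent sections. -/
theorem nonempty_hom (E E' : SaavedraUnit lam U) : Nonempty (E ⟶ E') := by
  have loc : ∀ X : Over U, ∃ S ∈ J.over U X, ∀ ⦃Y : Over U⦄ (g : Y ⟶ X), S g →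
      Nonempty ({t : E.torsor.Sec Y // E.IsIdem t} × {t : E'.torsor.Sec Y // E'.IsIdem t}) := by
    intro X
    obtain ⟨S, hS, h⟩ := loc₂ E.torsor E'.torsor X
    refine ⟨S, hS, fun Y g hg => ?_⟩
    obtain ⟨l, l'⟩ := h g hg
    obtain ⟨t, ht⟩ := exists_isIdem l
    obtain ⟨t', ht'⟩ := exists_isIdem l'
    exact ⟨⟨t, ht⟩, ⟨t', ht'⟩⟩
  -- The local generators are pairs of idempotents, one in each unit; the morphism sends the first
  -- to the second.
  obtain ⟨ψ, hψ⟩ := exists_hom (T := E.torsor) (R := E'.torsor)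
    (fun X => {t : E.torsor.Sec X // E.IsIdem t} × {t : E'.torsor.Sec X // E'.IsIdem t})
    (fun e => e.1.1) (fun e => e.2.1) loc
    (by
      rintro Y Z h ⟨⟨t, ht⟩, t', ht'⟩ ⟨⟨s, hs⟩, s', hs'⟩ a ha
      dsimp only at ha ⊢
      subst ha
      -- Two idempotents in the source can differ only by a = 0, so compatibility reduces to
      -- uniqueness of idempotents in the target.
      rw [(ht.res h).eq_zero hs, zero_vadd]
      exact hs'.unique (ht'.res h))
    (fun e => by rw [e.1.2.toB_eq_zero, e.2.2.toB_eq_zero])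
  refine ⟨⟨ψ, hom_ext_local _ _ fun X => ?_⟩⟩
  obtain ⟨S, hS, h⟩ := loc X
  refine ⟨S, hS, fun Y g hg => ?_⟩
  obtain ⟨e⟩ := h g hg
  -- At (t, t) both composites give the idempotent t' of the target: ψ(φ(t, t)) = ψ(t) = t' and
  -- φ'(t', t') = t'.
  refine ⟨tmk e.1.1 e.1.1, ?_⟩
  rw [ap_comp, ap_comp, ap_tensorHom, e.1.2, hψ, e.2.2]

/-- Existence is the matching of idempotents; uniqueness is the `Subsingleton` instance on morphisms
of Saavedra units. -/
theorem uniqueHoms (lam : A ⟶ B) (U : C) : UniqueHoms (SaavedraUnit lam U) := fun E E' =>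
  ⟨Unique.mk' (h₁ := ⟨(nonempty_hom E E').some⟩) _⟩

/-! ### The constraints as morphisms of Saavedra units. -/

/-- The associativity constraint of Saavedra units. -/
noncomputable def assocUnit (E F G : SaavedraUnit lam U) :
    tensorUnit (tensorUnit E F) G ⟶ tensorUnit E (tensorUnit F G) where
  hom := assocHom E.torsor F.torsor G.torsor
  comm := by
    refine hom_ext_local _ _ fun X => ?_
    obtain ⟨S, hS, h⟩ := loc₃ E.torsor F.torsor G.torsor X
    refine ⟨S, hS, fun Y g hg => ?_⟩
    obtain ⟨l, k, m⟩ := h g hg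
    -- On this section both composites are the triple of φ(l, l), φ(k, k), φ(m, m), bracketed to the
    -- right; the diagonal suffices because one local section determines an equivariant map.
    refine ⟨tmk (tmk (tmk l k) m) (tmk (tmk l k) m), ?_⟩
    simp only [ap_comp, ap_wedge, ap_tensorHom, ap_assocHom]

/-- The commutativity constraint of Saavedra units. -/
noncomputable def braidingUnit (E F : SaavedraUnit lam U) :
    tensorUnit E F ⟶ tensorUnit F E where
  hom := braiding E.torsor F.torsor
  comm := by
    refine hom_ext_local _ _ fun X => ?_
    obtain ⟨S, hS, h⟩ := loc₂ E.torsor F.torsor X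
    refine ⟨S, hS, fun Y g hg => ?_⟩
    obtain ⟨l, k⟩ := h g hg
    refine ⟨tmk (tmk l k) (tmk l k), ?_⟩
    simp only [ap_comp, ap_wedge, ap_tensorHom, ap_braiding]

/-- The comparison `f^*E ⊗ f^*F ⟶ f^*(E ⊗ F)` for Saavedra units. -/
noncomputable def restrictTensorUnit (f : V ⟶ U) (E F : SaavedraUnit lam U) :
    tensorUnit (restrictUnit f E) (restrictUnit f F) ⟶ restrictUnit f (tensorUnit E F) where
  hom := restrictTensor f E.torsor F.torsor
  comm := by
    refine hom_ext_local _ _ fun X => ?_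
    obtain ⟨S, hS, h⟩ := loc₂ (restrict f E.torsor) (restrict f F.torsor) X
    refine ⟨S, hS, fun Y g hg => ?_⟩
    obtain ⟨l, k⟩ := h g hg
    refine ⟨tmk (tmk l k) (tmk l k), ?_⟩
    rw [ap_comp, ap_wedge, ap_restrictUnit_φ, ap_restrictUnit_φ, ap_restrictTensor, ap_comp,
      ap_tensorHom, ap_restrictTensor]
    -- A section of the restriction is by definition a section over the image object, so `ap_wedge`
    -- over `U` applies after unfolding.
    exact ((ap_restrictUnit_φ f (tensorUnit E F) _ _).trans
      (ap_wedge E.φ F.φ (ofRestrict f E.torsor l) (ofRestrict f E.torsor l)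
        (ofRestrict f F.torsor k) (ofRestrict f F.torsor k))).symm

end SaavedraUnit

open SaavedraUnit

/-! ### Assembling the Picard stack. -/

/-- The Picard category of Saavedra units over `U`. -/
noncomputable def unitPicardCategory (lam : A ⟶ B) (U : C) : PicardCategory (unitTensor lam U) :=
  UniqueHoms.picardCategory (T := tensorFunctor lam U) (uniqueHoms lam U) (nonempty lam U)
    assocUnit braidingUnit

/-- Restriction of Saavedra units is an additive functor. -/
noncomputable def unitAdditiveFunctor (lam : A ⟶ B) (f : V ⟶ U) :
    AdditiveFunctor (unitPicardCategory lam U) (unitPicardCategory lam V)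
      ((unitStack lam).map f.op.toLoc).toFunctor where
  μ E F := (uniqueHoms lam V).iso (restrictTensorUnit f E F)
  μ_naturality _ _ := (uniqueHoms lam V).eq _ _
  μ_assoc _ _ _ := (uniqueHoms lam V).eq _ _
  μ_comm _ _ := (uniqueHoms lam V).eq _ _

/-- The Picard stack of Saavedra units. -/
noncomputable def unitPicardStack (lam : A ⟶ B) :
    PicardStack J (unitStack lam) (unitTensor lam) where
  isStack := isStack_of_uniqueHoms J _ (uniqueHoms lam) (nonempty lam)
  picard := unitPicardCategory lam
  additive := unitAdditiveFunctor lam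
  μ_id U _ _ := (uniqueHoms lam U).eq _ _
  μ_comp {_ _ W} _ _ _ _ := (uniqueHoms lam W).eq _ _

end Fibres

end SaavedraUnits

open CategoryTheory Opposite SaavedraUnits in
theorem mainTheorem1 {C : Type u} [Category.{v} C] (J : GrothendieckTopology C)
    (A B : Sheaf J AddCommGrpCat.{max u v}) (lam : A ⟶ B) :
    ∃ P : PicardStack J (unitStack lam) (unitTensor lam),
      (∀ (U : C) (E F G : SaavedraUnit lam U),
        SaavedraUnit.Hom.hom ((P.picard U).assoc E F G).hom =
          ABTorsor.assocHom E.torsor F.torsor G.torsor) ∧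
      (∀ (U : C) (E F : SaavedraUnit lam U),
        SaavedraUnit.Hom.hom ((P.picard U).comm E F).hom =
          ABTorsor.braiding E.torsor F.torsor) ∧
      (∀ (U V : C) (f : V ⟶ U) (E F : SaavedraUnit lam U),
        SaavedraUnit.Hom.hom ((P.additive f).μ E F).hom =
          ABTorsor.restrictTensor f E.torsor F.torsor) := by
  -- The identifications hold definitionally because `UniqueHoms.iso` keeps the given morphism as
  -- its `hom` and chooses only the inverse.
  exact ⟨unitPicardStack lam, fun _ _ _ _ => rfl, fun _ _ _ => rfl, fun _ _ _ _ _ => rfl⟩
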